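/- A free $\mathbb{Z}_2$-action on a space is given by a continuous involution without fixed points, and a $\mathbb{Z}_2$-map is a continuous map commuting with the involutions. A space is $n$-connected if, for every $-1\le i\le n$, every continuous map from the $i$-sphere to it extends to the $(i+1)$-ball; in particular $(-1)$-connected means nonempty. Let $k\ge 0$ be an integer. (1) Let $X$ and $Y$ be simplicial complexes with free $\mathbb{Z}_2$-actions, the action on $X$ being simplicial, such that $\dim X\le k$ and $Y$ is $(k-1)$-connected. Let $d\ge -1$ and let $\psi\colon X^{(d)}\to Y$ be a $\mathbb{Z}_2$-map defined on the $d$-skeleton of $X$ (where $X^{(-1)}=\emptyset$). Then there is a $\mathbb{Z}_2$-map $\varphi\colon X\to Y$ extending $\psi$. (2) Let $X$ be a $\mathbb{Z}_2$-space, i.e. a CW complex with a free $\mathbb{Z}_2$-action, and assume that $X$ is $(k-1)$-connected. Then there is a $\mathbb{Z}_2$-map $S^k_a\to X$, where $S^k_a$ is the unit sphere in $\mathbb{R}^{k+1}$ with the antipodal involution. Moreover $\varpi_1^k(X)\neq 0$ in $H^k(X/\mathbb{Z}_2;\mathbb{Z}_2)$. Here $\varpi_1^k(X)$ is the $k$-th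 cup power (the unit class for $k=0$) of the Stiefel-Whitney class $\varpi_1(X)=(w/\mathbb{Z}_2)^*(z)\in H^1(X/\mathbb{Z}_2;\mathbb{Z}_2)$, where $w\colon X\to S^\infty_a$ is any $\mathbb{Z}_2$-map to the infinite sphere with the antipodal involution and $z$ is the nonzero class in $H^1(\mathbb{RP}^\infty;\mathbb{Z}_2)$. -/

import Mathlib

noncomputable section

namespace ZTwo

universe u v w

/-! ### Free involutions and equivariant maps -/

/-- A free `ℤ₂`-action on a topological space: a continuous involution without fixed points. -/
structure FreeInvolution (X : Type u) [TopologicalSpace X] where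
  toMap : C(X, X)
  involutive : Function.Involutive toMap
  free : ∀ x, toMap x ≠ x

/-- A `ℤ₂`-map: a continuous map commuting with the involutions. -/
structure EquivMap {X : Type u} {Y : Type v} [TopologicalSpace X] [TopologicalSpace Y]
    (τ : FreeInvolution X) (υ : FreeInvolution Y) where
  toMap : C(X, Y)
  map_inv : ∀ x, toMap (τ.toMap x) = υ.toMap (toMap x)

section Orbit

variable {X : Type u} {Y : Type v} [TopologicalSpace X] [TopologicalSpace Y]

/-- Two points are equivalent when they lie in the same orbit of the involution. -/
def FreeInvolution.orbitSetoid (τ : FreeInvolution X) : Setoid X where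
  r x y := y = x ∨ y = τ.toMap x
  iseqv := by
    refine ⟨fun x => Or.inl rfl, ?_, ?_⟩
    · rintro x y (rfl | rfl)
      · exact Or.inl rfl
      · exact Or.inr (τ.involutive x).symm
    · rintro x y z (rfl | rfl) (rfl | rfl)
      · exact Or.inl rfl
      · exact Or.inr rfl
      · exact Or.inr rfl
      · exact Or.inl (τ.involutive x)

/-- The orbit space `X/ℤ₂`. -/
def FreeInvolution.Orbit (τ : FreeInvolution X) : Type u := Quotient τ.orbitSetoid

/-- The orbit space carries the quotient topology. -/
instance (τ : FreeInvolution X) : TopologicalSpace τ.Orbit :=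
  inferInstanceAs (TopologicalSpace (Quotient τ.orbitSetoid))

/-- The map `φ/ℤ₂ : X/ℤ₂ → Y/ℤ₂` induced by a `ℤ₂`-map `φ : X → Y`. -/
def EquivMap.mapOrbit {τ : FreeInvolution X} {υ : FreeInvolution Y} (φ : EquivMap τ υ) :
    C(τ.Orbit, υ.Orbit) where
  toFun := Quotient.map φ.toMap (by
    rintro x y (rfl | rfl)
    · exact Or.inl rfl
    · exact Or.inr (φ.map_inv x))
  continuous_toFun := φ.toMap.continuous.quotient_map' _

end Orbit

/-! ### Higher connectivity -/

/-- `X` is `n`-connected: for `-1 ≤ i ≤ n` every continuous map from the `i`-sphere to `X` extends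
to the `(i+1)`-ball. Here `l = i + 1`, so that the sphere in `ℝ^l` has dimension `i`; for `l = 0`
it is empty while the ball is a point, so a `(-1)`-connected space is just a nonempty one. -/
def IsNConnected (n : ℤ) (X : Type u) [TopologicalSpace X] : Prop :=
  ∀ l : ℕ, (l : ℤ) ≤ n + 1 →
    ∀ f : C(Metric.sphere (0 : EuclideanSpace ℝ (Fin l)) 1, X),
      ∃ g : C(Metric.closedBall (0 : EuclideanSpace ℝ (Fin l)) 1, X),
        ∀ x, g ⟨x.1, Metric.sphere_subset_closedBall x.2⟩ = f x

/-! ### Coherent topologies -/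

/-- The topology on `E` coherent with (determined by) the subsets `P i`, each of which carries the
topology of coordinatewise convergence for the coordinates `c : E → (V → ℝ)`: a set is open if and
only if its trace on every `P i` is. -/
abbrev coherentTopology {E : Type u} {V : Type v} {ι : Type w} (c : E → V → ℝ) (P : ι → Set E) :
    TopologicalSpace E :=
  ⨆ i, TopologicalSpace.coinduced (Subtype.val : P i → E)
    (TopologicalSpace.induced (fun x : P i => c x.1) inferInstance)

/-- A self-map which relabels coordinates up to sign and permutes the pieces is continuous. -/
theorem continuous_coherent {E : Type u} {V : Type v} {ι : Type w} {c : E → V → ℝ}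
    {P : ι → Set E} (f : E → E) (m : (V → ℝ) → V → ℝ) (hm : Continuous m)
    (hf : ∀ x, c (f x) = m (c x)) (hP : ∀ i, ∃ j, Set.MapsTo f (P i) (P j)) :
    @Continuous E E (coherentTopology c P) (coherentTopology c P) f := by
  unfold coherentTopology
  rw [continuous_iSup_dom]
  intro i
  rw [continuous_coinduced_dom]
  obtain ⟨j, hj⟩ := hP i
  let ti : TopologicalSpace (P i) := TopologicalSpace.induced (fun x : P i => c x.1) inferInstance
  let tj : TopologicalSpace (P j) := TopologicalSpace.induced (fun x : P j => c x.1) inferInstance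
  have h1 : Continuous (hj.restrict f (P i) (P j)) := by
    rw [continuous_induced_rng]
    have : (fun x : P j => c x.1) ∘ hj.restrict f (P i) (P j)
        = m ∘ fun x : P i => c x.1 := by
      funext x
      exact hf x.1
    rw [this]
    exact hm.comp continuous_induced_dom
  have h2 : @Continuous (P j) E tj (coherentTopology c P) Subtype.val :=
    continuous_iff_coinduced_le.2 (le_iSup (fun i => TopologicalSpace.coinduced
      (Subtype.val : P i → E) (TopologicalSpace.induced (fun x : P i => c x.1) inferInstance)) j)
  exact @Continuous.comp _ _ _ ti tj (coherentTopology c P) _ _ h2 h1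

/-! ### Simplicial complexes with a `ℤ₂`-action -/

section Simplicial

variable {V : Type u}

/-- The geometric realization of an abstract simplicial complex, through barycentric
coordinates. -/
def Realization (K : AbstractSimplicialComplex V) : Type u :=
  {x : V →₀ ℝ // x.support ∈ K.faces ∧ (∀ v, 0 ≤ x v) ∧ ∑ v ∈ x.support, x v = 1}

/-- The realization has the topology coherent with its closed simplices. -/
instance (K : AbstractSimplicialComplex V) : TopologicalSpace (Realization K) :=
  coherentTopology (fun x v => x.1 v)
    (fun s : K.faces => {x : Realization K | x.1.support ⊆ s.1})

/-- `dim K ≤ k`: each simplex has at most `k + 1` vertices. -/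
def DimLE (K : AbstractSimplicialComplex V) (k : ℤ) : Prop :=
  ∀ s ∈ K.faces, (s.card : ℤ) ≤ k + 1

/-- The `d`-skeleton of the realization: the union of the simplices of dimension at most `d`. It is
empty for `d = -1`. -/
def skeleton (K : AbstractSimplicialComplex V) (d : ℤ) : Set (Realization K) :=
  {x | (x.1.support.card : ℤ) ≤ d + 1}

/-- A simplicial involution: an involution of the vertices taking simplices to simplices. -/
structure SimplicialInvolution (K : AbstractSimplicialComplex V) where
  onVertices : V → V
  involutive : Function.Involutive onVertices
  map_faces : ∀ s ∈ K.faces, s.map ⟨onVertices, involutive.injective⟩ ∈ K.faces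

variable {K : AbstractSimplicialComplex V}

/-- The map of the realization which is given by the involution on vertices and is affine on every
simplex. -/
def SimplicialInvolution.onPoints (σ : SimplicialInvolution K) (x : Realization K) :
    Realization K :=
  ⟨Finsupp.equivMapDomain σ.involutive.toPerm x.1, by
    have hs : (Finsupp.equivMapDomain σ.involutive.toPerm x.1).support
        = x.1.support.map ⟨σ.onVertices, σ.involutive.injective⟩ := rfl
    refine ⟨?_, fun v => ?_, ?_⟩
    · rw [hs]
      exact σ.map_faces _ x.2.1
    · exact x.2.2.1 _
    · rw [hs, Finset.sum_map]
      refine (Finset.sum_congr rfl fun v _ => ?_).trans x.2.2.2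
      show x.1 (σ.onVertices (σ.onVertices v)) = x.1 v
      rw [σ.involutive v]⟩

theorem SimplicialInvolution.onPoints_apply (σ : SimplicialInvolution K) (x : Realization K)
    (v : V) : (σ.onPoints x).1 v = x.1 (σ.onVertices v) := rfl

theorem SimplicialInvolution.support_onPoints (σ : SimplicialInvolution K) (x : Realization K) :
    (σ.onPoints x).1.support = x.1.support.map ⟨σ.onVertices, σ.involutive.injective⟩ := rfl

theorem SimplicialInvolution.onPoints_onPoints (σ : SimplicialInvolution K) :
    Function.Involutive σ.onPoints := fun x =>
  Subtype.ext (Finsupp.ext fun v => congrArg x.1 (σ.involutive v))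

theorem SimplicialInvolution.continuous_onPoints (σ : SimplicialInvolution K) :
    Continuous σ.onPoints := by
  refine continuous_coherent (c := fun (x : Realization K) v => x.1 v)
    (P := fun s : K.faces => {x : Realization K | x.1.support ⊆ s.1}) _
    (fun y v => y (σ.onVertices v)) (by fun_prop) (fun x => rfl) ?_
  intro s
  refine ⟨⟨_, σ.map_faces s.1 s.2⟩, fun x hx => ?_⟩
  exact Finset.map_subset_map.2 hx

theorem SimplicialInvolution.onPoints_mem_skeleton (σ : SimplicialInvolution K) {d : ℤ}
    {x : Realization K} (hx : x ∈ skeleton K d) : σ.onPoints x ∈ skeleton K d := by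
  show ((σ.onPoints x).1.support.card : ℤ) ≤ d + 1
  rw [σ.support_onPoints, Finset.card_map]
  exact hx

/-- The action is free when no point of the realization is fixed. -/
def SimplicialInvolution.IsFree (σ : SimplicialInvolution K) : Prop :=
  ∀ x : Realization K, σ.onPoints x ≠ x

/-- The realization of a free simplicial involution. -/
def SimplicialInvolution.realize (σ : SimplicialInvolution K) (hσ : σ.IsFree) :
    FreeInvolution (Realization K) where
  toMap := ⟨σ.onPoints, σ.continuous_onPoints⟩
  involutive := σ.onPoints_onPoints
  free := hσ

/-- The restriction of a free simplicial involution to the `d`-skeleton. -/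
def SimplicialInvolution.onSkeleton (σ : SimplicialInvolution K) (hσ : σ.IsFree) (d : ℤ) :
    FreeInvolution (skeleton K d) where
  toMap := ⟨fun x => ⟨σ.onPoints x.1, σ.onPoints_mem_skeleton x.2⟩,
    (σ.continuous_onPoints.comp continuous_subtype_val).subtype_mk _⟩
  involutive := fun x => Subtype.ext (σ.onPoints_onPoints x.1)
  free := fun x h => hσ x.1 (congrArg Subtype.val h)

end Simplicial

/-! ### Spheres with the antipodal action -/

/-- `S^k_a`: the unit sphere of `ℝ^(k+1)` with the antipodal involution. -/
def antipodal (k : ℕ) : FreeInvolution (Metric.sphere (0 : EuclideanSpace ℝ (Fin (k + 1))) 1) where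
  toMap := ⟨fun x => -x, continuous_neg⟩
  involutive := fun x => neg_neg x
  free := fun x h => ne_neg_of_mem_unit_sphere ℝ x h.symm

/-- `S^∞`: the sequences of real numbers with finite support and norm one. -/
def InfSphere : Type := {x : ℕ →₀ ℝ // ∑ i ∈ x.support, x i ^ 2 = 1}

/-- `S^∞` has the topology of the union of its subspheres `S^n`, which consist of the sequences
supported in `{0, …, n}`. -/
instance : TopologicalSpace InfSphere :=
  coherentTopology (fun x i => x.1 i)
    (fun n : ℕ => {x : InfSphere | x.1.support ⊆ Finset.range (n + 1)})

/-- `S^∞_a`: the infinite sphere with the antipodal involution. -/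
def antipodalInf : FreeInvolution InfSphere where
  toMap := ⟨fun x => ⟨-x.1, by simpa using x.2⟩, by
    refine continuous_coherent (c := fun (x : InfSphere) i => x.1 i)
      (P := fun n : ℕ => {x : InfSphere | x.1.support ⊆ Finset.range (n + 1)}) _
      (fun y i => -y i) (by fun_prop) (fun x => rfl) ?_
    intro n
    refine ⟨n, fun x hx => ?_⟩
    show (-x.1).support ⊆ _
    rw [Finsupp.support_neg]
    exact hx⟩
  involutive := fun x => Subtype.ext (neg_neg x.1)
  free := by
    intro x h
    have h1 : -x.1 = x.1 := congrArg Subtype.val h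
    have h2 : x.1 = 0 := by
      ext i
      have h3 : -(x.1 i) = x.1 i := by rw [← Finsupp.neg_apply, h1]
      rw [Finsupp.zero_apply]
      linarith
    have h4 := x.2
    simp [h2] at h4

/-! ### Singular cohomology with coefficients in `ℤ₂` and its cup product -/

section Cohomology

variable {X : Type u} {Y : Type v} [TopologicalSpace X] [TopologicalSpace Y]

/-- A singular `n`-simplex. -/
abbrev SingSimplex (n : ℕ) (X : Type u) [TopologicalSpace X] : Type u :=
  C(stdSimplex ℝ (Fin (n + 1)), X)

/-- The composition of a singular `n`-simplex with the affine map of standard simplices given by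
`f` on the vertices. -/
def SingSimplex.reindex {m n : ℕ} (s : SingSimplex n X) (f : Fin (m + 1) → Fin (n + 1)) :
    SingSimplex m X :=
  s.comp ⟨stdSimplex.map f, stdSimplex.continuous_map f⟩

theorem SingSimplex.reindex_reindex {l m n : ℕ} (s : SingSimplex n X)
    (f : Fin (m + 1) → Fin (n + 1)) (g : Fin (l + 1) → Fin (m + 1)) :
    SingSimplex.reindex (SingSimplex.reindex s f) g = SingSimplex.reindex s (f ∘ g) := by
  ext x
  exact congrArg s (stdSimplex.map_comp_apply g f x)

/-- The singular `n`-cochains with coefficients in `ℤ₂`. -/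
abbrev Cochain (n : ℕ) (X : Type u) [TopologicalSpace X] : Type u := SingSimplex n X → ZMod 2

/-- The coboundary operator: the sum of the values on the faces. No signs are needed mod 2. -/
def coboundary (n : ℕ) (X : Type u) [TopologicalSpace X] :
    Cochain n X →ₗ[ZMod 2] Cochain (n + 1) X where
  toFun a := fun s => ∑ i : Fin (n + 2), a (SingSimplex.reindex s i.succAbove)
  map_add' a b := by
    funext s
    simp [Finset.sum_add_distrib]
  map_smul' r a := by
    funext s
    simp [Finset.mul_sum]

/-- The cocycles. -/
abbrev cocycles (n : ℕ) (X : Type u) [TopologicalSpace X] : Submodule (ZMod 2) (Cochain n X) :=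
  LinearMap.ker (coboundary n X)

/-- The coboundaries. -/
def coboundaries : (n : ℕ) → (X : Type u) → [TopologicalSpace X] →
    Submodule (ZMod 2) (Cochain n X)
  | 0, _, _ => ⊥
  | n + 1, X, _ => LinearMap.range (coboundary n X)

/-- The singular cohomology `H^n(X; ℤ₂)`: cocycles modulo coboundaries. -/
abbrev Cohomology (n : ℕ) (X : Type u) [TopologicalSpace X] : Type u :=
  cocycles n X ⧸ (coboundaries n X).comap (cocycles n X).subtype

/-- The pullback of cochains along a continuous map. -/
def cochainMap (n : ℕ) (f : C(X, Y)) : Cochain n Y →ₗ[ZMod 2] Cochain n X where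
  toFun a := fun s => a (f.comp s)
  map_add' _ _ := rfl
  map_smul' _ _ := rfl

theorem coboundary_cochainMap (n : ℕ) (f : C(X, Y)) (a : Cochain n Y) :
    coboundary n X (cochainMap n f a) = cochainMap (n + 1) f (coboundary n Y a) := rfl

theorem cochainMap_mem_coboundaries (n : ℕ) (f : C(X, Y)) {a : Cochain n Y}
    (ha : a ∈ coboundaries n Y) : cochainMap n f a ∈ coboundaries n X := by
  cases n with
  | zero =>
    have h : a = 0 := ha
    rw [h, map_zero]
    exact Submodule.zero_mem _
  | succ n =>
    obtain ⟨b, rfl⟩ := ha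
    exact ⟨cochainMap n f b, rfl⟩

/-- The pullback of cocycles along a continuous map. -/
def cocycleMap (n : ℕ) (f : C(X, Y)) : cocycles n Y →ₗ[ZMod 2] cocycles n X :=
  (cochainMap n f).restrict fun a ha => by
    rw [LinearMap.mem_ker] at ha ⊢
    rw [coboundary_cochainMap, ha, map_zero]

/-- The homomorphism `f^* : H^n(Y; ℤ₂) → H^n(X; ℤ₂)`. -/
def cohomologyMap (n : ℕ) (f : C(X, Y)) : Cohomology n Y →ₗ[ZMod 2] Cohomology n X :=
  Submodule.mapQ _ _ (cocycleMap n f) fun _ ha => cochainMap_mem_coboundaries n f ha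

/-- The front face map, onto the first `p + 1` vertices. -/
def front {p q n : ℕ} (h : p + q = n) (i : Fin (p + 1)) : Fin (n + 1) := ⟨i, by omega⟩

/-- The back face map, onto the last `q + 1` vertices. -/
def back {p q n : ℕ} (h : p + q = n) (j : Fin (q + 1)) : Fin (n + 1) := ⟨p + j, by omega⟩

/-- The cup product of cochains: the value of `a` on the front face times that of `b` on the back
face. -/
def cochainCup {p q n : ℕ} (h : p + q = n) (a : Cochain p X) (b : Cochain q X) : Cochain n X :=
  fun s => a (SingSimplex.reindex s (front h)) * b (SingSimplex.reindex s (back h))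

/-- The Leibniz rule. -/
theorem coboundary_cochainCup {p q n : ℕ} (h : p + q = n) (a : Cochain p X) (b : Cochain q X) :
    coboundary n X (cochainCup h a b)
      = cochainCup (by omega) (coboundary p X a) b
        + cochainCup (by omega) a (coboundary q X b) := by
  funext s
  have e : (p + 1) + (q + 1) = n + 2 := by omega
  have hL : coboundary n X (cochainCup h a b) s
      = ∑ i : Fin ((p + 1) + (q + 1)), cochainCup h a b
          (SingSimplex.reindex s (Fin.succAbove (Fin.cast e i))) :=
    (Fintype.sum_equiv (finCongr e) _ _ fun i => rfl).symm
  rw [hL, Fin.sum_univ_add]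
  simp only [Pi.add_apply, cochainCup, coboundary, LinearMap.coe_mk, AddHom.coe_mk,
    SingSimplex.reindex_reindex]
  rw [Fin.sum_univ_castSucc (n := p + 1)
      (fun i => a (SingSimplex.reindex s (front _ ∘ Fin.succAbove i))),
    Fin.sum_univ_succ (n := q + 1)
      (fun i => b (SingSimplex.reindex s (back _ ∘ Fin.succAbove i))),
    add_mul, mul_add, Finset.sum_mul, Finset.mul_sum]
  have key : ∀ A B C C' D D' : ZMod 2, A = C → B = D → C' = D' →
      A + B = (C + C') + (D' + D) := by
    rintro A B C C' D D' rfl rfl rfl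
    have : C' + C' = 0 := CharTwo.add_self_eq_zero C'
    linear_combination -this
  refine key _ _ _ _ _ _ ?_ ?_ ?_
  · refine Finset.sum_congr rfl fun i _ => ?_
    congr 3
    · funext j
      ext
      simp only [Function.comp, front, Fin.succAbove, Fin.lt_def, Fin.val_castSucc, Fin.val_cast,
        Fin.val_castAdd]
      split_ifs <;> simp
    · funext j
      ext
      simp only [Function.comp, back, Fin.succAbove, Fin.lt_def, Fin.val_castSucc, Fin.val_cast,
        Fin.val_castAdd]
      split_ifs <;> simp <;> omega
  · refine Finset.sum_congr rfl fun i _ => ?_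
    congr 3
    · funext j
      ext
      simp only [Function.comp, front, Fin.succAbove, Fin.lt_def, Fin.val_castSucc, Fin.val_cast,
        Fin.val_natAdd]
      split_ifs <;> simp <;> omega
    · funext j
      ext
      simp only [Function.comp, back, Fin.succAbove, Fin.lt_def, Fin.val_castSucc, Fin.val_cast,
        Fin.val_natAdd, Fin.val_succ]
      split_ifs <;> simp <;> omega
  · congr 3
    · funext j
      ext
      simp only [Function.comp, front, Fin.succAbove, Fin.lt_def, Fin.val_castSucc, Fin.val_last]
      split_ifs <;> simp <;> omega
    · funext j
      ext
      simp only [Function.comp, back, Fin.succAbove, Fin.lt_def, Fin.val_castSucc, Fin.val_zero]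
      split_ifs <;> simp <;> omega

/-- The cup product of cocycles is a cocycle. -/
def cocycleCup {p q n : ℕ} (h : p + q = n) (a : cocycles p X) (b : cocycles q X) :
    cocycles n X :=
  ⟨cochainCup h a.1 b.1, by
    rw [LinearMap.mem_ker, coboundary_cochainCup, LinearMap.mem_ker.1 a.2, LinearMap.mem_ker.1 b.2]
    funext s
    simp [cochainCup]⟩

theorem cochainCup_mem_coboundaries_left {p q n : ℕ} (h : p + q = n) {a : Cochain p X}
    (ha : a ∈ coboundaries p X) (b : cocycles q X) :
    cochainCup h a b.1 ∈ coboundaries n X := by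
  cases p with
  | zero =>
    have h0 : a = 0 := ha
    have h1 : cochainCup h a b.1 = 0 := by
      funext s
      simp [cochainCup, h0]
    rw [h1]
    exact Submodule.zero_mem _
  | succ p =>
    obtain ⟨c, rfl⟩ := ha
    obtain ⟨n, rfl⟩ : ∃ m, n = m + 1 := ⟨p + q, by omega⟩
    refine ⟨cochainCup (by omega) c b.1, ?_⟩
    rw [coboundary_cochainCup, LinearMap.mem_ker.1 b.2]
    funext s
    simp [cochainCup]

theorem cochainCup_mem_coboundaries_right {p q n : ℕ} (h : p + q = n) (a : cocycles p X)
    {b : Cochain q X} (hb : b ∈ coboundaries q X) :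
    cochainCup h a.1 b ∈ coboundaries n X := by
  cases q with
  | zero =>
    have h0 : b = 0 := hb
    have h1 : cochainCup h a.1 b = 0 := by
      funext s
      simp [cochainCup, h0]
    rw [h1]
    exact Submodule.zero_mem _
  | succ q =>
    obtain ⟨c, rfl⟩ := hb
    obtain ⟨n, rfl⟩ : ∃ m, n = m + 1 := ⟨p + q, by omega⟩
    refine ⟨cochainCup (by omega) a.1 c, ?_⟩
    rw [coboundary_cochainCup, LinearMap.mem_ker.1 a.2]
    funext s
    simp [cochainCup]

/-- The cup product of cohomology classes. -/
def cup {p q n : ℕ} (h : p + q = n) (x : Cohomology p X) (y : Cohomology q X) :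
    Cohomology n X :=
  Quotient.map₂ (cocycleCup h) (by
    intro a a' ha b b' hb
    have ha1 := (Submodule.quotientRel_def _).1 ha
    have hb1 := (Submodule.quotientRel_def _).1 hb
    refine (Submodule.quotientRel_def _).2 ?_
    have hsum : cochainCup h a.1 b.1 - cochainCup h a'.1 b'.1
        = cochainCup h (a.1 - a'.1) b.1 + cochainCup h a'.1 (b.1 - b'.1) := by
      funext s
      simp only [cochainCup, Pi.sub_apply, Pi.add_apply]
      ring
    show cochainCup h a.1 b.1 - cochainCup h a'.1 b'.1 ∈ coboundaries n X
    rw [hsum]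
    exact Submodule.add_mem _ (cochainCup_mem_coboundaries_left h ha1 b)
      (cochainCup_mem_coboundaries_right h a' hb1)) x y

/-- The unit class in `H^0(X; ℤ₂)`, represented by the constant cochain `1`. -/
def cohomologyOne (X : Type u) [TopologicalSpace X] : Cohomology 0 X :=
  Submodule.Quotient.mk ⟨fun _ => 1, by
    rw [LinearMap.mem_ker]
    funext s
    show ∑ _i : Fin 2, (1 : ZMod 2) = 0
    decide⟩

/-- The `k`-th cup power of a class of degree one. -/
def cupPow (x : Cohomology 1 X) : (k : ℕ) → Cohomology k X
  | 0 => cohomologyOne X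
  | k + 1 => cup rfl (cupPow x k) x

end Cohomology

/-! ### The Stiefel-Whitney class -/

/-- Infinite real projective space. -/
abbrev RPInf : Type := antipodalInf.Orbit

/-- The nontrivial class `z` in `H^1(RP^∞; ℤ₂)`. -/
def rpClass : Cohomology 1 RPInf := Classical.epsilon fun z => z ≠ 0

open scoped Classical in
/-- The Stiefel-Whitney class `ϖ₁(X) = (w/ℤ₂)^*(z)` in `H^1(X/ℤ₂; ℤ₂)`, where `w : X → S^∞_a` is a
`ℤ₂`-map. The value `0` given when there is no such map plays no role for CW complexes, for which
`w` exists and is unique up to equivariant homotopy. -/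
def stiefelWhitney {X : Type u} [TopologicalSpace X] (τ : FreeInvolution X) :
    Cohomology 1 τ.Orbit :=
  if h : Nonempty (EquivMap τ antipodalInf) then cohomologyMap 1 h.some.mapOrbit rpClass else 0

end ZTwo

end

namespace ZTwo

universe u v w

/-! For part (1), a free simplicial involution moves every simplex off itself, so a map may be
chosen on one simplex of each orbit and is then forced on its mirror image. The choice is possible
because a map on the boundary of a simplex of dimension at most `k` extends over the simplex when
the target is `(k-1)`-connected. `exists_extension_of_step` turns this single step into a global map
by Zorn's lemma. The maps from spheres in part (2) arise in the same way, one hemisphere at a time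
(`exists_odd_map`).

The Stiefel-Whitney class requires an equivariant map `w : X → S^∞`, built cell by cell from an
equivariant Tietze theorem (`nonempty_equivMap_antipodalInf`), and a nonzero class on `RP^∞`
(`exists_cohomology_ne_zero`). Any such map and any such class will do, so no uniqueness enters.

The power is detected on a map `S^k → X → X/ℤ₂`. A cocycle representing `z` pulls back to the
contractible space `S^∞` as a coboundary `δη`, and non-triviality of `z` forces `η(-x) = η(x) + 1`
(`exists_cochain_of_not_mem_coboundaries`). Thus `η` labels the vertices `± e_i` of the
cross-polytope, opposite vertices receiving opposite labels. The `k`-th power of the cocycle is `1`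
on a simplex exactly when the labels alternate along its ordered vertices (`cochainPow_apply`). The
simplices of the upper hemisphere become a mod 2 cycle in `X/ℤ₂` (`sum_coboundary_crossSimplex`),
and exactly one of them is alternating (`sum_prod_add_eq_one`). The power has value `1` on a cycle,
so it is not a coboundary. -/

/-! ### Extension principles: Zorn's lemma and simplices as balls. -/

/-- A function given on a family of pieces and satisfying a local condition there extends to all
pieces, provided that it can always be extended to some further piece. -/
theorem exists_extension_of_step {ι : Type u} {X : Type v} {Y : Type w} (P : ι → Set X)
    (D : ι → Set ι) (Good : ι → (X → Y) → Prop)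
    (hcongr : ∀ i f g, Set.EqOn f g (P i) → Good i f → Good i g)
    (hstep : ∀ (E : Set ι) (f : X → Y), (∀ i ∈ E, D i ⊆ E) → (∀ i ∈ E, Good i f) →
      E ≠ Set.univ → ∃ (E' : Set ι) (g : X → Y), E ⊂ E' ∧ (∀ i ∈ E', D i ⊆ E') ∧
        (∀ i ∈ E', Good i g) ∧ ∀ i ∈ E, Set.EqOn f g (P i))
    (E₀ : Set ι) (f₀ : X → Y) (hD : ∀ i ∈ E₀, D i ⊆ E₀) (hG : ∀ i ∈ E₀, Good i f₀) :
    ∃ g : X → Y, (∀ i, Good i g) ∧ ∀ i ∈ E₀, Set.EqOn f₀ g (P i) := by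
  classical
  -- Only a preorder: functions are compared on the pieces already treated and are arbitrary
  -- elsewhere.
  let r : Set ι × (X → Y) → Set ι × (X → Y) → Prop :=
    fun p q => p.1 ⊆ q.1 ∧ ∀ i ∈ p.1, Set.EqOn p.2 q.2 (P i)
  have r_trans : ∀ {p q t}, r p q → r q t → r p t := fun h1 h2 =>
    ⟨h1.1.trans h2.1, fun i hi => (h1.2 i hi).trans (h2.2 i (h1.1 hi))⟩
  have r_refl : ∀ p, r p p := fun p => ⟨subset_rfl, fun i _ => Set.eqOn_refl _ _⟩
  let valid : Set ι × (X → Y) → Prop :=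
    fun p => (∀ i ∈ p.1, D i ⊆ p.1) ∧ (∀ i ∈ p.1, Good i p.2) ∧ r (E₀, f₀) p
  obtain ⟨m, hm⟩ := exists_maximal_of_chains_bounded
    (r := fun p q : {p // valid p} => r p.1 q.1) (by
      intro c hc
      rcases c.eq_empty_or_nonempty with rfl | ⟨p₀, hp₀⟩
      · exact ⟨⟨(E₀, f₀), hD, hG, r_refl _⟩, fun a ha => ha.elim⟩
      -- The choice of chain member is harmless, since comparable members agree on the pieces of the
      -- smaller one.
      let g : X → Y := fun x =>
        if h : ∃ p ∈ c, ∃ i ∈ p.1.1, x ∈ P i then h.choose.1.2 x else f₀ x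
      have hg : ∀ p ∈ c, ∀ i ∈ p.1.1, Set.EqOn p.1.2 g (P i) := by
        intro p hp i hi x hx
        have h : ∃ p ∈ c, ∃ i ∈ p.1.1, x ∈ P i := ⟨p, hp, i, hi, hx⟩
        obtain ⟨hq, j, hj, hxj⟩ := h.choose_spec
        have hgx : g x = h.choose.1.2 x := dif_pos h
        rw [hgx]
        by_cases e : p = h.choose
        · rw [← e]
        rcases hc hp hq e with h1 | h1
        · exact h1.2 i hi hx
        · exact (h1.2 j hj hxj).symm
      let q : Set ι × (X → Y) := (⋃ p ∈ c, p.1.1, g)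
      have hq : ∀ p ∈ c, r p.1 q := fun p hp =>
        ⟨Set.subset_biUnion_of_mem (u := fun p : {p // valid p} => p.1.1) hp, hg p hp⟩
      refine ⟨⟨q, ?_, ?_, r_trans p₀.2.2.2 (hq p₀ hp₀)⟩, hq⟩
      · intro i hi
        obtain ⟨p, hp, hip⟩ := Set.mem_iUnion₂.1 hi
        exact (p.2.1 i hip).trans (hq p hp).1
      · intro i hi
        obtain ⟨p, hp, hip⟩ := Set.mem_iUnion₂.1 hi
        exact hcongr i _ _ (hg p hp i hip) (p.2.2.1 i hip))
    (fun h1 h2 => r_trans h1 h2)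
  have huniv : m.1.1 = Set.univ := by
    by_contra hne
    obtain ⟨E', g, hE, hD', hG', hfg⟩ := hstep m.1.1 m.1.2 m.2.1 m.2.2.1 hne
    have hr : r m.1 (E', g) := ⟨hE.1, hfg⟩
    exact hE.2 (hm ⟨(E', g), hD', hG', r_trans m.2.2.2 hr⟩ hr).1
  exact ⟨m.1.2, fun i => m.2.2.1 i (huniv ▸ Set.mem_univ i), fun i hi => m.2.2.2.2 i hi⟩

/-- If maps from the sphere in `ℝ^l` to `Y` extend to the ball, then maps from the boundary of a
simplex with `l + 1` vertices to `Y` extend to the simplex. -/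
theorem exists_extend_stdSimplex {ι : Type u} [Fintype ι] {Y : Type v} [TopologicalSpace Y]
    {l : ℕ} (hcard : Fintype.card ι = l + 1)
    (hY : ∀ f : C(Metric.sphere (0 : EuclideanSpace ℝ (Fin l)) 1, Y),
      ∃ g : C(Metric.closedBall (0 : EuclideanSpace ℝ (Fin l)) 1, Y),
        ∀ x, g ⟨x.1, Metric.sphere_subset_closedBall x.2⟩ = f x)
    (f : stdSimplex ℝ ι → Y) (hf : ContinuousOn f {x | ∃ v, x v = 0}) :
    ∃ g : C(stdSimplex ℝ ι, Y), ∀ x, (∃ v, x v = 0) → g x = f x := by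
  classical
  -- The simplex becomes a convex body in `ℝ^l`, and a homeomorphism of `ℝ^l` takes that body to the
  -- unit ball and its frontier to the sphere. The frontier consists of the points with a vanishing
  -- barycentric coordinate.
  obtain ⟨b⟩ := AffineBasis.exists_affineBasis_of_finiteDimensional (k := ℝ)
    (V := EuclideanSpace ℝ (Fin l)) (P := EuclideanSpace ℝ (Fin l)) (ι := ι) (by simpa using hcard)
  set s : Set (EuclideanSpace ℝ (Fin l)) := convexHull ℝ (Set.range b) with hs
  have hcompact : IsCompact s := (Set.finite_range b).isCompact_convexHull ℝ
  obtain ⟨h, -, h2, h3⟩ := exists_homeomorph_image_interior_closure_frontier_eq_unitBall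
    (convex_convexHull ℝ (Set.range b)) ⟨_, b.centroid_mem_interior_convexHull⟩
    hcompact.isBounded
  have hmem : ∀ x, x ∈ s ↔ ∀ v, 0 ≤ b.coord v x := by
    intro x
    rw [hs, b.convexHull_eq_nonneg_coord]
    rfl
  rw [← hs, hcompact.isClosed.closure_eq] at h2
  rw [← hs] at h3
  have hfront : ∀ x, x ∈ frontier s ↔ x ∈ s ∧ ∃ v, b.coord v x = 0 := by
    intro x
    have hint : x ∈ interior s ↔ ∀ v, 0 < b.coord v x := by
      rw [hs, b.interior_convexHull]
      rfl
    rw [hcompact.isClosed.frontier_eq, Set.mem_sdiff, hint]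
    simp only [not_forall, not_lt]
    exact and_congr_right fun h0 => exists_congr fun v =>
      ⟨fun h1 => le_antisymm h1 ((hmem x).1 h0 v), fun h1 => h1.le⟩
  -- the simplex as a convex body
  let α : stdSimplex ℝ ι → EuclideanSpace ℝ (Fin l) := fun x => ∑ v, x v • b v
  have hα : Continuous α := by
    have h0 : ∀ v, Continuous fun x : stdSimplex ℝ ι => x v := fun v =>
      (continuous_apply v).comp continuous_subtype_val
    exact continuous_finsetSum _ fun v _ => (h0 v).smul continuous_const
  have hcoord : ∀ x v, b.coord v (α x) = x v := by
    intro x v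
    have : α x = Finset.univ.affineCombination ℝ b x := by
      rw [Finset.affineCombination_eq_linear_combination _ _ _ (stdSimplex.sum_eq_one x)]
    rw [this, b.coord_apply_combination_of_mem (Finset.mem_univ v) (stdSimplex.sum_eq_one x)]
  have hαs : ∀ x, α x ∈ s := by
    intro x
    rw [hmem]
    intro v
    rw [hcoord]
    exact stdSimplex.zero_le x v
  let β : s → stdSimplex ℝ ι := fun y => ⟨fun v => b.coord v y.1,
    fun v => (hmem y.1).1 y.2 v, b.sum_coord_apply_eq_one y.1⟩
  have hβ : Continuous β := by
    refine Continuous.subtype_mk (continuous_pi fun v => ?_) _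
    exact (AffineMap.continuous_of_finiteDimensional (b.coord v)).comp continuous_subtype_val
  have hβα : ∀ x, β ⟨α x, hαs x⟩ = x := by
    intro x
    apply stdSimplex.ext
    funext v
    exact hcoord x v
  have hsph : ∀ z : Metric.sphere (0 : EuclideanSpace ℝ (Fin l)) 1, h.symm z.1 ∈ frontier s := by
    intro z
    obtain ⟨y, hy, hyz⟩ : z.1 ∈ h '' frontier s := h3.symm ▸ z.2
    rw [← hyz, h.symm_apply_apply]
    exact hy
  let γ : Metric.sphere (0 : EuclideanSpace ℝ (Fin l)) 1 → stdSimplex ℝ ι := fun z =>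
    β ⟨h.symm z.1, ((hfront _).1 (hsph z)).1⟩
  have hγ : Continuous γ :=
    hβ.comp ((h.symm.continuous.comp continuous_subtype_val).subtype_mk _)
  have hγx : ∀ x (hx : h (α x) ∈ Metric.sphere (0 : EuclideanSpace ℝ (Fin l)) 1),
      γ ⟨h (α x), hx⟩ = x := by
    intro x hx
    have h1 : ∀ y (hy : y ∈ s), y = α x → β ⟨y, hy⟩ = x := by
      rintro y hy rfl
      exact hβα x
    exact h1 _ _ (h.symm_apply_apply _)
  obtain ⟨g, hg⟩ := hY ⟨f ∘ γ, hf.comp_continuous hγ fun z => ((hfront _).1 (hsph z)).2⟩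
  have hball : ∀ x, h (α x) ∈ Metric.closedBall (0 : EuclideanSpace ℝ (Fin l)) 1 := fun x => by
    rw [← h2]
    exact ⟨_, hαs x, rfl⟩
  refine ⟨g.comp ⟨fun x => ⟨h (α x), hball x⟩, (h.continuous.comp hα).subtype_mk _⟩, ?_⟩
  rintro x ⟨v, hv⟩
  have hx : h (α x) ∈ Metric.sphere (0 : EuclideanSpace ℝ (Fin l)) 1 := by
    rw [← h3]
    exact ⟨_, (hfront _).2 ⟨hαs x, v, by rw [hcoord, hv]⟩, rfl⟩
  exact (hg ⟨_, hx⟩).trans (congrArg f (hγx x hx))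

/-! ### Characteristic maps of faces and equivariant extension over simplicial complexes. -/

section SimplicialExtension

variable {V : Type u} {K : AbstractSimplicialComplex V}

theorem Realization.support_nonempty (x : Realization K) : x.1.support.Nonempty := by
  rw [Finset.nonempty_iff_ne_empty]
  intro h
  have := x.2.2.2
  rw [h] at this
  simp at this

theorem mem_faces_of_subset {s t : Finset V} (hs : s ∈ K.faces) (hts : t ⊆ s)
    (ht : t.Nonempty) : t ∈ K.faces := by
  have := K.isRelLowerSet_faces hs
  exact this.2 hts ht

open scoped Classical in
/-- The characteristic map of a face. -/
noncomputable def simplexMap (s : K.faces) (x : stdSimplex ℝ s.1) : Realization K :=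
  ⟨Finsupp.onFinset s.1 (fun v => if h : v ∈ s.1 then x ⟨v, h⟩ else 0)
      fun v hv => by by_contra h; simp [h] at hv, by
    have hsub : (Finsupp.onFinset s.1 (fun v => if h : v ∈ s.1 then x ⟨v, h⟩ else 0)
      fun v hv => by by_contra h; simp [h] at hv).support ⊆ s.1 := Finsupp.support_onFinset_subset
    have hsum : ∑ v ∈ s.1, (if h : v ∈ s.1 then x ⟨v, h⟩ else 0) = 1 := by
      rw [← Finset.sum_coe_sort]
      refine (Finset.sum_congr rfl fun v _ => ?_).trans (stdSimplex.sum_eq_one x)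
      simp
    have hsum' : ∑ v ∈ (Finsupp.onFinset s.1 (fun v => if h : v ∈ s.1 then x ⟨v, h⟩ else 0)
        fun v hv => by by_contra h; simp [h] at hv).support,
        (if h : v ∈ s.1 then x ⟨v, h⟩ else 0) = 1 := by
      rw [← hsum]
      exact Finset.sum_subset hsub fun v _ hv => by simpa using hv
    refine ⟨mem_faces_of_subset s.2 hsub ?_, fun v => ?_, hsum'⟩
    · rw [Finset.nonempty_iff_ne_empty]
      intro h
      rw [h] at hsum'
      simp at hsum'
    · rw [Finsupp.onFinset_apply]
      split_ifs
      · exact stdSimplex.zero_le x _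
      · exact le_rfl⟩

open scoped Classical in
theorem simplexMap_apply (s : K.faces) (x : stdSimplex ℝ s.1) (v : V) :
    (simplexMap s x).1 v = if h : v ∈ s.1 then x ⟨v, h⟩ else 0 := rfl

theorem simplexMap_apply_of_notMem (s : K.faces) (x : stdSimplex ℝ s.1) {v : V} (h : v ∉ s.1) :
    (simplexMap s x).1 v = 0 := by
  rw [simplexMap_apply, dif_neg h]

theorem support_simplexMap_subset (s : K.faces) (x : stdSimplex ℝ s.1) :
    (simplexMap s x).1.support ⊆ s.1 := by
  intro v hv
  by_contra h
  exact Finsupp.mem_support_iff.1 hv (simplexMap_apply_of_notMem s x h)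

theorem simplexMap_apply_coe (s : K.faces) (x : stdSimplex ℝ s.1) (v : s.1) :
    (simplexMap s x).1 v = x v := by
  rw [simplexMap_apply, dif_pos v.2]

/-- The barycentric coordinates of a point of a face. -/
def faceCoords (s : K.faces) (x : Realization K) (hx : x.1.support ⊆ s.1) : stdSimplex ℝ s.1 :=
  ⟨fun v => x.1 v, fun v => x.2.2.1 v, by
    refine (Finset.sum_coe_sort s.1 (fun v => x.1 v)).trans (Eq.trans ?_ x.2.2.2)
    exact (Finset.sum_subset hx fun v _ hv => by simpa using hv).symm⟩

theorem simplexMap_faceCoords (s : K.faces) (x : Realization K) (hx : x.1.support ⊆ s.1) :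
    simplexMap s (faceCoords s x hx) = x := by
  refine Subtype.ext (Finsupp.ext fun v => ?_)
  rw [simplexMap_apply]
  split_ifs with h
  · rfl
  · by_contra h1
    exact h (hx (Finsupp.mem_support_iff.2 fun h2 => h1 h2.symm))

theorem faceCoords_simplexMap (s : K.faces) (x : stdSimplex ℝ s.1)
    (hx : (simplexMap s x).1.support ⊆ s.1) : faceCoords s (simplexMap s x) hx = x :=
  stdSimplex.ext (funext fun v => simplexMap_apply_coe s x v)

theorem exists_eq_zero_of_support_ssubset (s : K.faces) {x : stdSimplex ℝ s.1}
    (hx : (simplexMap s x).1.support ≠ s.1) : ∃ v, x v = 0 := by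
  by_contra! h
  refine hx ((support_simplexMap_subset s x).antisymm fun v hv => ?_)
  rw [Finsupp.mem_support_iff, simplexMap_apply, dif_pos hv]
  exact h _

/-- The topology of coordinatewise convergence on a closed face. -/
abbrev faceTopology (s : K.faces) : TopologicalSpace {x : Realization K | x.1.support ⊆ s.1} :=
  TopologicalSpace.induced (fun x v => x.1.1 v) inferInstance

/-- A closed face with coordinatewise convergence is homeomorphic to a standard simplex, by
`simplexMap` and `faceCoords`, so the coherent topology is detected by characteristic maps. -/
theorem continuous_realization_iff {Y : Type v} [TopologicalSpace Y] {f : Realization K → Y} :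
    Continuous f ↔ ∀ s : K.faces, Continuous (f ∘ simplexMap s) := by
  have hmap : ∀ s : K.faces, @Continuous _ _ _ (faceTopology s)
        (fun x => (⟨simplexMap s x, support_simplexMap_subset s x⟩ :
          {x : Realization K | x.1.support ⊆ s.1})) := by
    intro s
    refine continuous_induced_rng.2 (continuous_pi fun v => ?_)
    by_cases h : v ∈ s.1
    · refine ((continuous_apply (⟨v, h⟩ : s.1)).comp continuous_subtype_val).congr fun x => ?_
      exact (simplexMap_apply_coe s x ⟨v, h⟩).symm
    · exact (continuous_const (y := (0 : ℝ))).congr fun x =>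
      (simplexMap_apply_of_notMem s x h).symm
  have hcoe : ∀ s : K.faces, @Continuous _ _ (faceTopology s) _
      (fun x : {x : Realization K | x.1.support ⊆ s.1} => faceCoords s x.1 x.2) := by
    intro s
    let t := faceTopology s
    refine continuous_induced_rng.2 ?_
    refine (@continuous_pi_iff _ _ _ t _ _).2 fun v => ?_
    exact @Continuous.comp _ _ _ t _ _ _ _ (continuous_apply v.1) continuous_induced_dom
  have hiff : Continuous f ↔ ∀ s : K.faces, @Continuous _ _ (faceTopology s) _
      (fun x : {x : Realization K | x.1.support ⊆ s.1} => f x.1) := by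
    refine continuous_iSup_dom.trans (forall_congr' fun s => ?_)
    exact continuous_coinduced_dom
  rw [hiff]
  refine forall_congr' fun s => ⟨fun h => ?_, fun h => ?_⟩
  · exact @Continuous.comp _ _ _ _ (faceTopology s) _ _
      (fun x : {x : Realization K | x.1.support ⊆ s.1} => f x.1) h (hmap s)
  · have h1 := @Continuous.comp _ _ _ (faceTopology s) _ _ _ _ h (hcoe s)
    refine @Continuous.congr _ _ (faceTopology s) _ _ _ h1 fun x => ?_
    exact congrArg f (simplexMap_faceCoords s x.1 x.2)

theorem continuous_simplexMap (s : K.faces) : Continuous (simplexMap s) :=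
  continuous_realization_iff.1 continuous_id s

theorem continuous_coord (v : V) : Continuous fun x : Realization K => x.1 v := by
  rw [continuous_realization_iff]
  intro s
  by_cases h : v ∈ s.1
  · refine ((continuous_apply (⟨v, h⟩ : s.1)).comp continuous_subtype_val).congr fun x => ?_
    exact (simplexMap_apply_coe s x ⟨v, h⟩).symm
  · exact (continuous_const (y := (0 : ℝ))).congr fun x =>
      (simplexMap_apply_of_notMem s x h).symm

theorem continuous_faceCoords {A : Type v} [TopologicalSpace A] (s : K.faces)
    {f : A → Realization K} (hf : Continuous f) (h : ∀ a, (f a).1.support ⊆ s.1) :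
    Continuous fun a => faceCoords s (f a) (h a) :=
  Continuous.subtype_mk (continuous_pi fun v : s.1 => (continuous_coord v.1).comp hf) _

/-- The image of a face under a simplicial involution. -/
def SimplicialInvolution.onFaces (σ : SimplicialInvolution K) (s : K.faces) : K.faces :=
  ⟨_, σ.map_faces s.1 s.2⟩

theorem SimplicialInvolution.onFaces_onFaces (σ : SimplicialInvolution K) (s : K.faces) :
    σ.onFaces (σ.onFaces s) = s := by
  refine Subtype.ext ?_
  show (s.1.map _).map _ = s.1
  rw [Finset.map_map]
  refine Eq.trans ?_ Finset.map_refl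
  congr 1
  ext v
  exact σ.involutive v

theorem SimplicialInvolution.support_onPoints_subset (σ : SimplicialInvolution K)
    {x : Realization K} {s : K.faces} (hx : x.1.support ⊆ s.1) :
    (σ.onPoints x).1.support ⊆ (σ.onFaces s).1 := Finset.map_subset_map.2 hx

/-- The barycenter of an invariant face would be a fixed point. -/
theorem SimplicialInvolution.IsFree.onFaces_ne {σ : SimplicialInvolution K} (hσ : σ.IsFree)
    (s : K.faces) : σ.onFaces s ≠ s := by
  intro h
  have hne : s.1.Nonempty := (K.isRelLowerSet_faces s.2).1
  have hcard : (0 : ℝ) < s.1.card := by exact_mod_cast hne.card_pos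
  let b : stdSimplex ℝ s.1 := ⟨fun _ => (s.1.card : ℝ)⁻¹, fun _ => by positivity, by
    simp [hcard.ne']⟩
  refine hσ (simplexMap s b) (Subtype.ext (Finsupp.ext fun v => ?_))
  rw [σ.onPoints_apply, simplexMap_apply, simplexMap_apply]
  have hiff : σ.onVertices v ∈ s.1 ↔ v ∈ s.1 := by
    have h1 : (σ.onFaces s).1 = s.1 := congrArg Subtype.val h
    have h2 : ∀ w, w ∈ s.1 → σ.onVertices w ∈ s.1 := fun w hw => by
      rw [← h1]
      exact Finset.mem_map_of_mem _ hw
    exact ⟨fun h3 => by simpa [σ.involutive v] using h2 _ h3, h2 v⟩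
  by_cases hv : v ∈ s.1
  · rw [dif_pos hv, dif_pos (hiff.2 hv)]
    rfl
  · rw [dif_neg hv, dif_neg fun h3 => hv (hiff.1 h3)]

/-- A function which is continuous on all proper faces is continuous on the boundary. -/
theorem continuousOn_boundary {Y : Type v} [TopologicalSpace Y] (f : Realization K → Y)
    (s : K.faces) (h : ∀ t : K.faces, t.1 ⊂ s.1 → Continuous (f ∘ simplexMap t)) :
    ContinuousOn (f ∘ simplexMap s) {x | ∃ v, x v = 0} := by
  classical
  have hcl : ∀ v : s.1, IsClosed {x : stdSimplex ℝ s.1 | x v = 0} := fun v =>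
    isClosed_eq ((continuous_apply v).comp continuous_subtype_val) continuous_const
  have hset : {x : stdSimplex ℝ s.1 | ∃ v, x v = 0} = ⋃ v : s.1, {x | x v = 0} := by
    ext x
    simp
  rw [hset]
  -- The boundary is a finite union of closed facets. On the facet opposite `v` the map factors
  -- through the characteristic map of that facet, which is empty when `v` is the only vertex.
  refine (locallyFinite_of_finite _).continuousOn_iUnion hcl fun v => ?_
  rw [continuousOn_iff_continuous_domRestrict]
  by_cases he : (s.1.erase v.1).Nonempty
  · have hsub : s.1.erase v.1 ⊂ s.1 := Finset.erase_ssubset v.2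
    let t : K.faces := ⟨s.1.erase v.1, mem_faces_of_subset s.2 hsub.1 he⟩
    have ht : ∀ x : {x : stdSimplex ℝ s.1 | x v = 0}, (simplexMap s x.1).1.support ⊆ t.1 := by
      intro x w hw
      refine Finset.mem_erase.2 ⟨?_, support_simplexMap_subset s x.1 hw⟩
      rintro rfl
      rw [Finsupp.mem_support_iff, simplexMap_apply_coe] at hw
      exact hw x.2
    refine ((h t hsub).comp (continuous_faceCoords t
      ((continuous_simplexMap s).comp continuous_subtype_val) ht)).congr fun x => ?_
    exact congrArg f (simplexMap_faceCoords t _ (ht x))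
  · have hempty : IsEmpty {x : stdSimplex ℝ s.1 | x v = 0} := by
      refine ⟨fun x => he ?_⟩
      obtain ⟨w, hw⟩ := (simplexMap s x.1).support_nonempty
      refine ⟨w, Finset.mem_erase.2 ⟨?_, support_simplexMap_subset s x.1 hw⟩⟩
      rintro rfl
      rw [Finsupp.mem_support_iff, simplexMap_apply_coe] at hw
      exact hw x.2
    exact continuous_of_const fun x => hempty.elim x

/-- Equivariant extension over a free simplicial complex of dimension at most `k`, to an arbitrary
target which is `(k-1)`-connected. -/
theorem exists_equivMap_extending (σ : SimplicialInvolution K) (hσ : σ.IsFree) {Y : Type v}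
    [TopologicalSpace Y] (τ : FreeInvolution Y) (k : ℕ) (hK : DimLE K k)
    (hY : IsNConnected ((k : ℤ) - 1) Y) (d : ℤ) (ψ : EquivMap (σ.onSkeleton hσ d) τ) :
    ∃ φ : EquivMap (σ.realize hσ) τ, ∀ x : skeleton K d, φ.toMap x.1 = ψ.toMap x := by
  classical
  obtain ⟨y₀⟩ : Nonempty Y := by
    obtain ⟨g, -⟩ := hY 0 (by push_cast; omega) ⟨fun x => absurd x.2 (by
      rw [Subsingleton.elim x.1 0]; simp), by
        refine continuous_of_const fun x => absurd x.2 (by rw [Subsingleton.elim x.1 0]; simp)⟩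
    exact ⟨g ⟨0, by simp⟩⟩
  let f₀ : Realization K → Y := fun x => if h : x ∈ skeleton K d then ψ.toMap ⟨x, h⟩ else y₀
  obtain ⟨g, hg, hg₀⟩ := exists_extension_of_step
    -- A piece is a face with its mirror image. The dependency sets keep a family closed under
    -- subfaces and under the involution.
    (fun s : K.faces => {x : Realization K | x.1.support ⊆ s.1 ∨ x.1.support ⊆ (σ.onFaces s).1})
    (fun s => {t | t.1 ⊆ s.1 ∨ t = σ.onFaces s})
    (fun s f => Continuous (f ∘ simplexMap s) ∧
      ∀ x : Realization K, x.1.support ⊆ s.1 → f (σ.onPoints x) = τ.toMap (f x))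
    (by
      rintro s f g hfg ⟨h1, h2⟩
      refine ⟨h1.congr fun x => hfg (Or.inl (support_simplexMap_subset s x)), fun x hx => ?_⟩
      rw [← hfg (Or.inl hx), ← hfg (Or.inr (σ.support_onPoints_subset hx))]
      exact h2 x hx)
    (by
      intro E f hD hG hE
      obtain ⟨s, hs, hmin⟩ : ∃ s, s ∉ E ∧ ∀ t : K.faces, t.1.card < s.1.card → t ∈ E := by
        obtain ⟨a, ha⟩ := (Set.ne_univ_iff_exists_notMem E).1 hE
        obtain ⟨s, hs, hm⟩ := exists_minimalFor_of_wellFoundedLT (· ∉ E)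
          (fun s : K.faces => s.1.card) ⟨a, ha⟩
        refine ⟨s, hs, fun t ht => ?_⟩
        by_contra h
        exact absurd (hm h ht.le) (not_le.2 ht)
      have hσE : ∀ t ∈ E, σ.onFaces t ∈ E := fun t ht => hD t ht (Or.inr rfl)
      have hσs : σ.onFaces s ∉ E := fun h => hs (by simpa [σ.onFaces_onFaces] using hσE _ h)
      have hprop : ∀ t : K.faces, t.1 ⊂ s.1 → t ∈ E := fun t ht => hmin t (Finset.card_lt_card ht)
      have hcard : s.1.card = (s.1.card - 1) + 1 :=
        (Nat.sub_add_cancel (K.isRelLowerSet_faces s.2).1.card_pos).symm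
      -- Here the dimension bound meets the connectivity: `s` has at most `k + 1` vertices, so its
      -- boundary is a sphere of dimension at most `k - 1`.
      obtain ⟨g, hg⟩ := exists_extend_stdSimplex (ι := s.1) (Y := Y) (l := s.1.card - 1)
        (by simpa using hcard) (hY _ (by have := hK s.1 s.2; omega)) (f ∘ simplexMap s)
        (continuousOn_boundary f s fun t ht => (hG t (hprop t ht)).1)
      have hsupp : ∀ x : Realization K, ∀ t ∈ E, x.1.support ⊆ t.1 →
          (⟨x.1.support, x.2.1⟩ : K.faces) ∈ E := fun x t ht hx => hD t ht (Or.inl hx)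
      -- the extension
      let F : Realization K → Y := fun x =>
        if h : x.1.support = s.1 then g (faceCoords s x h.subset)
        else if h : (σ.onPoints x).1.support = s.1 then
          τ.toMap (g (faceCoords s (σ.onPoints x) h.subset))
        else f x
      have hflip : ∀ x : Realization K, (σ.onPoints x).1.support = s.1 →
          x.1.support = (σ.onFaces s).1 := by
        intro x hx
        rw [← σ.onPoints_onPoints x, σ.support_onPoints, hx]
        rfl
      have hFE : ∀ x : Realization K, ∀ t ∈ E, x.1.support ⊆ t.1 → F x = f x := by
        intro x t ht hx
        have hxE := hsupp x t ht hx
        have h1 : x.1.support ≠ s.1 := fun h => hs ((Subtype.ext h : (⟨x.1.support, x.2.1⟩ : K.faces) = s) ▸ hxE)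
        have h2 : (σ.onPoints x).1.support ≠ s.1 := fun h =>
          hσs ((Subtype.ext (hflip x h) : (⟨x.1.support, x.2.1⟩ : K.faces) = σ.onFaces s) ▸ hxE)
        exact (dif_neg h1).trans (dif_neg h2)
      -- On the boundary of `s` the old map and `g` agree, so `F` is given by `g` on the whole
      -- closed face.
      have hFs : ∀ x : Realization K, ∀ hx : x.1.support ⊆ s.1, F x = g (faceCoords s x hx) := by
        intro x hx
        by_cases h : x.1.support = s.1
        · exact dif_pos h
        · have hE' : (⟨x.1.support, x.2.1⟩ : K.faces) ∈ E := hprop _ (hx.ssubset_of_ne h)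
          rw [hFE x _ hE' subset_rfl, hg, Function.comp, simplexMap_faceCoords]
          refine exists_eq_zero_of_support_ssubset s ?_
          rwa [simplexMap_faceCoords]
      have hFσ : ∀ x : Realization K, x.1.support ⊆ s.1 → F (σ.onPoints x) = τ.toMap (F x) := by
        intro x hx
        by_cases h : x.1.support = s.1
        · have h1 : (σ.onPoints x).1.support ≠ s.1 := by
            intro h2
            refine hσ.onFaces_ne s (Subtype.ext ?_)
            rw [← hflip x h2, h]
          rw [hFs x hx]
          have h3 : (σ.onPoints (σ.onPoints x)).1.support = s.1 := by rwa [σ.onPoints_onPoints]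
          refine (dif_neg h1).trans ((dif_pos h3).trans ?_)
          congr 3
          exact σ.onPoints_onPoints x
        · have hE' : (⟨x.1.support, x.2.1⟩ : K.faces) ∈ E := hprop _ (hx.ssubset_of_ne h)
          rw [hFE x _ hE' subset_rfl, hFE (σ.onPoints x) _ (hσE _ hE')
            (σ.support_onPoints_subset subset_rfl)]
          exact (hG _ hE').2 x subset_rfl
      refine ⟨E ∪ {s, σ.onFaces s}, F, ⟨Set.subset_union_left, fun h =>
        hs (h (Or.inr (Or.inl rfl)))⟩, ?_, ?_, ?_⟩
      · rintro t (ht | rfl | rfl)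
        · exact (hD t ht).trans Set.subset_union_left
        · rintro r (hr | rfl)
          · by_cases h : r = t
            · exact Or.inr (Or.inl h)
            · exact Or.inl (hprop r (hr.ssubset_of_ne fun h1 => h (Subtype.ext h1)))
          · exact Or.inr (Or.inr rfl)
        · rintro r (hr | rfl)
          · by_cases h : r = σ.onFaces s
            · exact Or.inr (Or.inr h)
            · refine Or.inl (hmin r ?_)
              have h1 := Finset.card_lt_card (hr.ssubset_of_ne fun h1 => h (Subtype.ext h1))
              rwa [show (σ.onFaces s).1.card = s.1.card from Finset.card_map _] at h1
          · exact Or.inr (Or.inl (σ.onFaces_onFaces s))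
      · rintro t (ht | rfl | rfl)
        · refine ⟨(hG t ht).1.congr fun x =>
            (hFE _ t ht (support_simplexMap_subset t x)).symm, fun x hx => ?_⟩
          rw [hFE x t ht hx, hFE _ _ (hσE t ht) (σ.support_onPoints_subset hx)]
          exact (hG t ht).2 x hx
        · refine ⟨g.continuous.congr fun x => ?_, hFσ⟩
          rw [Function.comp, hFs _ (support_simplexMap_subset t x), faceCoords_simplexMap]
        · have hsub : ∀ x : Realization K, x.1.support ⊆ (σ.onFaces s).1 →
              (σ.onPoints x).1.support ⊆ s.1 := by
            intro x hx
            have := σ.support_onPoints_subset hx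
            rwa [σ.onFaces_onFaces] at this
          have hF' : ∀ x : Realization K, x.1.support ⊆ (σ.onFaces s).1 →
              F x = τ.toMap (F (σ.onPoints x)) := by
            intro x hx
            rw [← hFσ _ (hsub x hx), σ.onPoints_onPoints]
          refine ⟨?_, fun x hx => ?_⟩
          · have hc := continuous_faceCoords s (σ.continuous_onPoints.comp
              (continuous_simplexMap (σ.onFaces s))) fun x =>
                hsub _ (support_simplexMap_subset (σ.onFaces s) x)
            refine (τ.toMap.continuous.comp (g.continuous.comp hc)).congr fun x => ?_
            rw [Function.comp_apply (f := F), hF' _ (support_simplexMap_subset _ x), hFs]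
            rfl
          · rw [hF' x hx, τ.involutive]
      · rintro t ht x (hx | hx)
        · exact (hFE x t ht hx).symm
        · exact (hFE x _ (hσE t ht) hx).symm)
    {s | (s.1.card : ℤ) ≤ d + 1} f₀
    (by
      rintro s hs t (ht | rfl)
      · have := Finset.card_le_card ht
        have hs' : (s.1.card : ℤ) ≤ d + 1 := hs
        show (t.1.card : ℤ) ≤ d + 1
        omega
      · show ((s.1.map _).card : ℤ) ≤ d + 1
        rw [Finset.card_map]
        exact hs)
    (by
      intro s hs
      have hs' : (s.1.card : ℤ) ≤ d + 1 := hs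
      have hmem : ∀ x : Realization K, x.1.support ⊆ s.1 → x ∈ skeleton K d := by
        intro x hx
        have := Finset.card_le_card hx
        show (x.1.support.card : ℤ) ≤ d + 1
        omega
      constructor
      · refine (ψ.toMap.continuous.comp ((continuous_simplexMap s).subtype_mk fun x =>
          hmem _ (support_simplexMap_subset s x))).congr fun x => ?_
        have h1 : f₀ (simplexMap s x) = _ := dif_pos (hmem _ (support_simplexMap_subset s x))
        exact h1.symm
      · intro x hx
        have h1 := hmem x hx
        have h2 := σ.onPoints_mem_skeleton h1
        show dite _ _ _ = τ.toMap (dite _ _ _)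
        rw [dif_pos h1, dif_pos h2]
        exact ψ.map_inv ⟨x, h1⟩)
  refine ⟨⟨⟨g, continuous_realization_iff.2 fun s => (hg s).1⟩, fun x =>
    (hg ⟨_, x.2.1⟩).2 x subset_rfl⟩, fun x => ?_⟩
  refine (hg₀ ⟨_, x.1.2.1⟩ x.2 (Or.inl subset_rfl)).symm.trans ?_
  exact dif_pos x.2

end SimplicialExtension

/-! ### Equivariant maps from finite-dimensional spheres. -/

/-- Into a `(k-1)`-connected space with a free involution there are equivariant maps from the
spheres of dimension at most `k`. -/
theorem exists_odd_map {X : Type u} [TopologicalSpace X] (τ : FreeInvolution X) {k : ℕ}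
    (hX : IsNConnected ((k : ℤ) - 1) X) : ∀ l : ℕ, l ≤ k + 1 →
      ∃ f : C(Metric.sphere (0 : EuclideanSpace ℝ (Fin l)) 1, X),
        ∀ x, f (-x) = τ.toMap (f x) := by
  intro l
  induction l with
  | zero =>
    intro _
    have hempty : IsEmpty (Metric.sphere (0 : EuclideanSpace ℝ (Fin 0)) 1) :=
      ⟨fun x => absurd x.2 (by rw [Subsingleton.elim x.1 0]; simp)⟩
    exact ⟨⟨fun x => hempty.elim x, continuous_of_const fun x => hempty.elim x⟩,
      fun x => hempty.elim x⟩
  | succ l ih =>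
    intro hl
    obtain ⟨f, hf⟩ := ih (by omega)
    obtain ⟨g, hg⟩ := hX l (by omega) f
    -- Dropping the last coordinate projects each closed hemisphere onto the ball and the equator
    -- onto its bounding sphere.
    let ini : EuclideanSpace ℝ (Fin (l + 1)) → EuclideanSpace ℝ (Fin l) :=
      fun x => WithLp.toLp 2 fun i => x i.castSucc
    have hini : Continuous ini := by fun_prop
    have hnorm : ∀ x, ‖x‖ ^ 2 = ‖ini x‖ ^ 2 + x (Fin.last l) ^ 2 := by
      intro x
      rw [EuclideanSpace.norm_sq_eq, EuclideanSpace.norm_sq_eq, Fin.sum_univ_castSucc]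
      simp [ini]
    have hx1 : ∀ x : Metric.sphere (0 : EuclideanSpace ℝ (Fin (l + 1))) 1, ‖x.1‖ = 1 :=
      fun x => mem_sphere_zero_iff_norm.1 x.2
    have hball : ∀ x : Metric.sphere (0 : EuclideanSpace ℝ (Fin (l + 1))) 1,
        ini x.1 ∈ Metric.closedBall (0 : EuclideanSpace ℝ (Fin l)) 1 := by
      intro x
      have h := hnorm x.1
      rw [hx1] at h
      rw [mem_closedBall_zero_iff]
      nlinarith [sq_nonneg (x.1 (Fin.last l)), norm_nonneg (ini x.1)]
    let p : Metric.sphere (0 : EuclideanSpace ℝ (Fin (l + 1))) 1 →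
        Metric.closedBall (0 : EuclideanSpace ℝ (Fin l)) 1 := fun x => ⟨ini x.1, hball x⟩
    have hp : Continuous p := (hini.comp continuous_subtype_val).subtype_mk _
    have hsph : ∀ x : Metric.sphere (0 : EuclideanSpace ℝ (Fin (l + 1))) 1,
        x.1 (Fin.last l) = 0 → ini x.1 ∈ Metric.sphere (0 : EuclideanSpace ℝ (Fin l)) 1 := by
      intro x h0
      have h := hnorm x.1
      rw [hx1, h0] at h
      rw [mem_sphere_zero_iff_norm]
      nlinarith [norm_nonneg (ini x.1)]
    have heq : ∀ x : Metric.sphere (0 : EuclideanSpace ℝ (Fin (l + 1))) 1,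
        x.1 (Fin.last l) = 0 → g (p (-x)) = τ.toMap (g (p x)) := by
      intro x h0
      have h1 : g (p x) = f ⟨_, hsph x h0⟩ := hg ⟨_, hsph x h0⟩
      have h2 : g (p (-x)) = f (-⟨_, hsph x h0⟩) := hg (-⟨_, hsph x h0⟩)
      rw [h1, h2, hf]
    have hlast : Continuous fun x : Metric.sphere (0 : EuclideanSpace ℝ (Fin (l + 1))) 1 =>
        x.1 (Fin.last l) := by fun_prop
    -- The extension `g` gives the upper hemisphere and equivariance the lower one. They match on
    -- the equator, where `g` restricts to the odd map `f`.
    refine ⟨⟨fun x => if 0 ≤ x.1 (Fin.last l) then g (p x) else τ.toMap (g (p (-x))), ?_⟩, ?_⟩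
    · refine Continuous.if_le (g.continuous.comp hp)
        (τ.toMap.continuous.comp (g.continuous.comp (hp.comp continuous_neg))) continuous_const
        hlast fun x hx => ?_
      rw [heq x hx.symm, τ.involutive]
    · intro x
      have hl' : (-x).1 (Fin.last l) = -x.1 (Fin.last l) := rfl
      show ite _ _ _ = τ.toMap (ite _ _ _)
      rw [hl', neg_neg]
      rcases lt_trichotomy (x.1 (Fin.last l)) 0 with h | h | h
      · rw [if_pos (by linarith), if_neg (by linarith), τ.involutive]
      · rw [if_pos (by linarith), if_pos (by linarith), heq x h]
      · rw [if_neg (by linarith), if_pos (by linarith)]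

theorem nonempty_equivMap_antipodal {X : Type u} [TopologicalSpace X] (τ : FreeInvolution X)
    {k : ℕ} (hX : IsNConnected ((k : ℤ) - 1) X) : Nonempty (EquivMap (antipodal k) τ) := by
  obtain ⟨f, hf⟩ := exists_odd_map τ hX (k + 1) le_rfl
  exact ⟨⟨f, hf⟩⟩

/-! ### The infinite sphere -/

namespace InfSphere

/-- The topology of coordinatewise convergence on a finite-dimensional subsphere. -/
abbrev subsphereTopology (n : ℕ) :
    TopologicalSpace {x : InfSphere | x.1.support ⊆ Finset.range (n + 1)} :=
  TopologicalSpace.induced (fun x i => x.1.1 i) inferInstance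

theorem continuous_iff {Y : Type v} [TopologicalSpace Y] {f : InfSphere → Y} :
    Continuous f ↔ ∀ n : ℕ, @Continuous _ _ (subsphereTopology n) _
      (fun x : {x : InfSphere | x.1.support ⊆ Finset.range (n + 1)} => f x.1) :=
  continuous_iSup_dom.trans (forall_congr' fun _ => continuous_coinduced_dom)

theorem continuous_coord (i : ℕ) : Continuous fun x : InfSphere => x.1 i := by
  rw [continuous_iff]
  intro n
  let t := subsphereTopology n
  exact (continuous_apply i).comp (continuous_induced_dom
    (f := fun (x : {x : InfSphere | x.1.support ⊆ Finset.range (n + 1)}) i => x.1.1 i))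

/-- The common bound `n` is essential: the topology of `S^∞` is finer than coordinatewise
convergence and agrees with it on each finite subsphere. -/
theorem continuous_of_coord {A : Type u} [TopologicalSpace A] {f : A → InfSphere} (n : ℕ)
    (hn : ∀ a, (f a).1.support ⊆ Finset.range (n + 1))
    (hf : ∀ i, Continuous fun a => (f a).1 i) : Continuous f := by
  let t := subsphereTopology n
  have h1 : Continuous fun a => (⟨f a, hn a⟩ :
      {x : InfSphere | x.1.support ⊆ Finset.range (n + 1)}) :=
    continuous_induced_rng.2 (continuous_pi hf)
  exact (continuous_iff.1 (continuous_id (X := InfSphere)) n).comp h1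

instance : T2Space InfSphere := by
  refine T2Space.of_injective_continuous (f := fun (x : InfSphere) (i : ℕ) => x.1 i) ?_
    (continuous_pi continuous_coord)
  exact fun x y h => Subtype.ext (Finsupp.ext fun i => congrFun h i)

theorem sum_sq_eq_one {n : ℕ} (x : InfSphere) (hx : x.1.support ⊆ Finset.range n) :
    ∑ i ∈ Finset.range n, x.1 i ^ 2 = 1 := by
  refine Eq.trans ?_ x.2
  exact (Finset.sum_subset hx fun v _ hv => by simpa using hv).symm

/-- A compact subset of `S^∞` lies in a finite-dimensional subsphere. -/
theorem exists_support_subset_of_isCompact {A : Set InfSphere} (hA : IsCompact A) :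
    ∃ n : ℕ, ∀ x ∈ A, x.1.support ⊆ Finset.range n := by
  classical
  -- The weights make `φ` at least `i` at some point of `A` whenever the `i`-th coordinate does not
  -- vanish identically on `A`. On each subsphere `φ` is a finite sum, so it is continuous and
  -- therefore bounded on `A`.
  let a : ℕ → ℝ := fun i => if h : ∃ x ∈ A, x.1 i ≠ 0 then i / |h.choose.1 i| else 0
  let φ : InfSphere → ℝ := fun x => ∑ i ∈ x.1.support, a i * |x.1 i|
  have ha : ∀ i, 0 ≤ a i := by
    intro i
    show 0 ≤ dite _ _ _
    split_ifs
    · positivity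
    · exact le_rfl
  have hφ : Continuous φ := by
    rw [continuous_iff]
    intro n
    let t := subsphereTopology n
    have h1 : Continuous fun x : {x : InfSphere | x.1.support ⊆ Finset.range (n + 1)} =>
        ∑ i ∈ Finset.range (n + 1), a i * |x.1.1 i| := by
      refine continuous_finsetSum _ fun i _ => continuous_const.mul (Continuous.abs ?_)
      exact (continuous_iff.1 (continuous_coord i) n)
    refine h1.congr fun x => ?_
    exact (Finset.sum_subset x.2 fun v _ hv => by
      rw [Finsupp.notMem_support_iff.1 hv]; simp).symm
  obtain ⟨M, hM⟩ := (hA.image hφ).bddAbove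
  obtain ⟨n, hn⟩ := exists_nat_gt M
  refine ⟨n, fun x hx i hi => ?_⟩
  rw [Finset.mem_range]
  by_contra! hni
  have h : ∃ x ∈ A, x.1 i ≠ 0 := ⟨x, hx, Finsupp.mem_support_iff.1 hi⟩
  obtain ⟨hy, hyi⟩ := h.choose_spec
  have h1 : φ h.choose ≤ M := hM ⟨_, hy, rfl⟩
  have h2 : a i * |h.choose.1 i| ≤ φ h.choose :=
    Finset.single_le_sum (f := fun i => a i * |h.choose.1 i|)
      (fun j _ => mul_nonneg (ha j) (abs_nonneg _)) (Finsupp.mem_support_iff.2 hyi)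
  have h3 : a i = i / |h.choose.1 i| := dif_pos h
  rw [h3, div_mul_cancel₀ _ (abs_ne_zero.2 hyi)] at h2
  have h4 : (n : ℝ) ≤ i := by exact_mod_cast hni
  linarith

/-- The point of `S^∞` in the direction of a nonzero vector. -/
noncomputable def normalize (n : ℕ) (v : ℕ → ℝ) (hv : 0 < ∑ i ∈ Finset.range n, v i ^ 2) :
    InfSphere :=
  ⟨Finsupp.onFinset (Finset.range n)
    (fun i => if i < n then v i / √(∑ i ∈ Finset.range n, v i ^ 2) else 0)
    (fun i hi => by by_contra h; simp_all), by
    rw [Finset.sum_subset (s₂ := Finset.range n) Finsupp.support_onFinset_subset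
      (fun i _ hi => by rw [Finsupp.notMem_support_iff.1 hi]; simp)]
    have h1 : ∀ i ∈ Finset.range n,
        (if i < n then v i / √(∑ i ∈ Finset.range n, v i ^ 2) else 0) ^ 2
          = v i ^ 2 / ∑ i ∈ Finset.range n, v i ^ 2 := by
      intro i hi
      rw [if_pos (Finset.mem_range.1 hi), div_pow, Real.sq_sqrt hv.le]
    refine (Finset.sum_congr rfl h1).trans ?_
    rw [← Finset.sum_div, div_self hv.ne']⟩

theorem normalize_apply (n : ℕ) (v : ℕ → ℝ) (hv : 0 < ∑ i ∈ Finset.range n, v i ^ 2) (i : ℕ) :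
    (normalize n v hv).1 i
      = if i < n then v i / √(∑ i ∈ Finset.range n, v i ^ 2) else 0 := rfl

theorem support_normalize_subset (n : ℕ) (v : ℕ → ℝ) (hv : 0 < ∑ i ∈ Finset.range n, v i ^ 2) :
    (normalize n v hv).1.support ⊆ Finset.range n := by
  intro i hi
  by_contra h
  rw [Finsupp.mem_support_iff, normalize_apply, if_neg (by simpa using h)] at hi
  exact hi rfl

theorem continuous_normalize {A : Type u} [TopologicalSpace A] {n : ℕ} {v : A → ℕ → ℝ}
    (hv : ∀ a, 0 < ∑ i ∈ Finset.range n, v a i ^ 2) (hc : ∀ i, Continuous fun a => v a i) :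
    Continuous fun a => normalize n (v a) (hv a) := by
  refine continuous_of_coord n (fun a => (support_normalize_subset n _ _).trans
    (Finset.range_mono (Nat.le_succ n))) fun i => ?_
  simp only [normalize_apply]
  by_cases h : i < n
  · simp only [h, if_true]
    refine (hc i).div (Real.continuous_sqrt.comp
      (continuous_finsetSum _ fun j _ => (hc j).pow 2)) fun a => ?_
    exact (Real.sqrt_pos.2 (hv a)).ne'
  · simp only [h, if_false]
    exact continuous_const

theorem coe_antipodal (x : InfSphere) (i : ℕ) : (antipodalInf.toMap x).1 i = -x.1 i := rfl

end InfSphere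

/-! ### Equivariant maps to the infinite sphere. -/

/-- Equivariant Tietze extension from a closed subset of a compact space to the infinite sphere. -/
theorem exists_equivMap_antipodalInf_extending {B : Type u} [TopologicalSpace B] [CompactSpace B]
    [T2Space B] (τ : FreeInvolution B) {A : Set B} (hA : IsClosed A)
    (hτ : ∀ x ∈ A, τ.toMap x ∈ A) (f : B → InfSphere) (hf : ContinuousOn f A)
    (hodd : ∀ x ∈ A, f (τ.toMap x) = antipodalInf.toMap (f x)) :
    ∃ g : EquivMap τ antipodalInf, Set.EqOn f g.toMap A := by
  classical
  obtain ⟨n, hn⟩ := InfSphere.exists_support_subset_of_isCompact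
    (hA.isCompact.image_of_continuousOn hf)
  have hn' : ∀ x ∈ A, (f x).1.support ⊆ Finset.range n := fun x hx => hn _ ⟨x, hx, rfl⟩
  -- Each coordinate extends by Tietze; the odd part of the extension keeps its values on `A`, where
  -- `f` is already odd.
  have hF : ∀ i : ℕ, ∃ F : C(B, ℝ), (∀ x, F (τ.toMap x) = -F x) ∧ ∀ x ∈ A, F x = (f x).1 i := by
    intro i
    obtain ⟨G, hG⟩ := ContinuousMap.exists_restrict_eq hA ⟨fun x : A => (f x).1 i,
      (InfSphere.continuous_coord i).comp (continuousOn_iff_continuous_domRestrict.1 hf)⟩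
    have hG' : ∀ x ∈ A, G x = (f x).1 i := fun x hx => DFunLike.congr_fun hG ⟨x, hx⟩
    refine ⟨⟨fun x => (G x - G (τ.toMap x)) / 2, by fun_prop⟩, fun x => ?_, fun x hx => ?_⟩
    · simp only [ContinuousMap.coe_mk, τ.involutive x]
      ring
    · simp only [ContinuousMap.coe_mk, hG' x hx, hG' _ (hτ x hx), hodd x hx,
        InfSphere.coe_antipodal]
      ring
  choose F hFodd hFA using hF
  -- By Urysohn, some function is `1` at `x` and `0` on `A` and at `τ x`; antisymmetrizing it leaves
  -- its value at `x` unchanged.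
  have hG : ∀ x : B, ∃ G : C(B, ℝ), (∀ y, G (τ.toMap y) = -G y) ∧ (∀ y ∈ A, G y = 0) ∧
      (x ∉ A → G x ≠ 0) := by
    intro x
    by_cases hx : x ∈ A
    · exact ⟨0, by simp, by simp, fun h => absurd hx h⟩
    obtain ⟨H, h0, h1, -⟩ := exists_continuous_zero_one_of_isClosed
      (hA.union (isClosed_singleton (x := τ.toMap x))) (isClosed_singleton (x := x)) (by
        rw [Set.disjoint_singleton_right]
        rintro (h | h)
        · exact hx h
        · exact τ.free x h.symm)
    refine ⟨⟨fun y => H y - H (τ.toMap y), by fun_prop⟩, fun y => ?_, fun y hy => ?_, fun _ => ?_⟩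
    · simp only [ContinuousMap.coe_mk, τ.involutive y]
      ring
    · simp only [ContinuousMap.coe_mk]
      rw [h0 (Or.inl hy), h0 (Or.inl (hτ y hy))]
      simp
    · simp only [ContinuousMap.coe_mk]
      rw [h0 (Or.inr rfl), h1 rfl]
      simp
  choose G hGodd hGA hGx using hG
  let Z : Set B := ⋂ i ∈ Finset.range n, {x | F i x = 0}
  have hZ : IsClosed Z := isClosed_biInter fun i _ => isClosed_eq (F i).continuous continuous_const
  have hsumA : ∀ x ∈ A, ∑ i ∈ Finset.range n, F i x ^ 2 = 1 := by
    intro x hx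
    rw [← InfSphere.sum_sq_eq_one (f x) (hn' x hx)]
    exact Finset.sum_congr rfl fun i _ => by rw [hFA i x hx]
  have hZA : ∀ x ∈ Z, x ∉ A := by
    intro x hx hxA
    have h1 := hsumA x hxA
    rw [Finset.sum_eq_zero fun i hi => by
      have : F i x = 0 := Set.mem_iInter₂.1 hx i hi
      rw [this]; simp] at h1
    exact zero_ne_one h1
  obtain ⟨t, ht⟩ := hZ.isCompact.elim_finite_subcover (fun x : B => {y | G x y ≠ 0})
    (fun x => isOpen_ne_fun (G x).continuous continuous_const)
    (fun x hx => Set.mem_iUnion.2 ⟨x, hGx x (hZA x hx)⟩)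
  let e := t.equivFin
  -- Finitely many functions `G`, placed after the first `n` coordinates, remove the common zeros of
  -- the `F i`. They vanish on `A`, where the vector already has norm one, so normalizing changes
  -- nothing there.
  let v : B → ℕ → ℝ := fun x i => if i < n then F i x else
    if h : i - n < t.card then G (e.symm ⟨i - n, h⟩) x else 0
  have hvc : ∀ i, Continuous fun x => v x i := by
    intro i
    by_cases h : i < n
    · simpa only [v, h, if_true] using (F i).continuous
    · by_cases h' : i - n < t.card
      · simpa only [v, h, if_false, h', dite_true] using (G _).continuous
      · simpa only [v, h, if_false, h', dite_false] using continuous_const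
  have hvodd : ∀ x i, v (τ.toMap x) i = -v x i := by
    intro x i
    simp only [v]
    split_ifs
    · exact hFodd i x
    · exact hGodd _ x
    · simp
  have hvpos : ∀ x, 0 < ∑ i ∈ Finset.range (n + t.card), v x i ^ 2 := by
    intro x
    have hex : ∃ i ∈ Finset.range (n + t.card), v x i ≠ 0 := by
      by_cases hx : x ∈ Z
      · obtain ⟨y, hy, hyx⟩ := Set.mem_iUnion₂.1 (ht hx)
        have h2 := (e ⟨y, hy⟩).2
        refine ⟨n + (e ⟨y, hy⟩ : ℕ), Finset.mem_range.2 (by omega), ?_⟩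
        have h3 : ¬ n + (e ⟨y, hy⟩ : ℕ) < n := by omega
        simp only [v, h3, if_false, Nat.add_sub_cancel_left, h2, dite_true]
        simpa using hyx
      · obtain ⟨i, hi, hix⟩ : ∃ i ∈ Finset.range n, F i x ≠ 0 := by
          by_contra! h
          exact hx (Set.mem_iInter₂.2 h)
        rw [Finset.mem_range] at hi
        refine ⟨i, Finset.mem_range.2 (by omega), ?_⟩
        simpa only [v, hi, if_true] using hix
    obtain ⟨i, hi, hix⟩ := hex
    exact Finset.sum_pos' (fun j _ => sq_nonneg _) ⟨i, hi, by positivity⟩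
  refine ⟨⟨⟨_, InfSphere.continuous_normalize hvpos hvc⟩, fun x => ?_⟩, fun x hx => ?_⟩
  · refine Subtype.ext (Finsupp.ext fun i => ?_)
    rw [InfSphere.coe_antipodal]
    simp only [ContinuousMap.coe_mk, InfSphere.normalize_apply, hvodd, neg_sq]
    split_ifs
    · rw [neg_div]
    · simp
  · have hval : ∀ i, v x i = (f x).1 i := by
      intro i
      simp only [v]
      split_ifs with h h'
      · exact hFA i x hx
      all_goals
        have h0 : (f x).1 i = 0 := by
          by_contra h2
          exact h (Finset.mem_range.1 (hn' x hx (Finsupp.mem_support_iff.2 h2)))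
        rw [h0]
      exact hGA _ x hx
    have hsub : (f x).1.support ⊆ Finset.range (n + t.card) :=
      (hn' x hx).trans (Finset.range_mono (Nat.le_add_right _ _))
    refine Subtype.ext (Finsupp.ext fun i => ?_)
    simp only [ContinuousMap.coe_mk, InfSphere.normalize_apply, hval,
      InfSphere.sum_sq_eq_one (f x) hsub, Real.sqrt_one, div_one]
    split_ifs with h
    · rfl
    · by_contra h2
      exact h (Finset.mem_range.1 (hsub (Finsupp.mem_support_iff.2 h2)))

open Topology.CWComplex in
/-- Every CW complex with a free involution has an equivariant map to the infinite sphere. -/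
theorem nonempty_equivMap_antipodalInf {X : Type u} [TopologicalSpace X] [T2Space X]
    [Topology.CWComplex (Set.univ : Set X)] (τ : FreeInvolution X) :
    Nonempty (EquivMap τ antipodalInf) := by
  classical
  let ι := Σ n, cell (Set.univ : Set X) n
  let oc : ι → Set X := fun e => openCell e.1 e.2
  let cc : ι → Set X := fun e => closedCell e.1 e.2
  -- A family closed under `D` contains every cell whose open cell meets one of its closed cells, as
  -- a subcomplex does.
  let D : ι → Set ι := fun e => {e' | (oc e' ∩ cc e).Nonempty}
  have hcover : ∀ x, ∃ e, x ∈ oc e := by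
    intro x
    have h : x ∈ ⋃ (n : ℕ) (j : cell (Set.univ : Set X) n), openCell n j := by
      rw [iUnion_openCell_eq_complex]
      trivial
    obtain ⟨n, j, hx⟩ := Set.mem_iUnion₂.1 h
    exact ⟨⟨n, j⟩, hx⟩
  have hdisj : ∀ {x e e'}, x ∈ oc e → x ∈ oc e' → e = e' := by
    intro x e e' h h'
    by_contra hne
    exact Set.disjoint_left.1 (disjoint_openCell_of_ne (i := e.2) (j := e'.2) hne) h h'
  have hclosed : ∀ E : Set ι, (∀ e ∈ E, D e ⊆ E) → ∀ S : Set X, S ⊆ ⋃ e ∈ E, cc e →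
      (∀ e ∈ E, IsClosed (S ∩ cc e)) → IsClosed S := by
    intro E hE S hS h
    -- Cells outside `E` need no test: `D`-closedness makes their open cells disjoint from `S`.
    refine isClosed_of_disjoint_openCell_or_isClosed_inter_closedCell (Set.subset_univ S)
      fun n _ j => ?_
    by_cases hj : (⟨n, j⟩ : ι) ∈ E
    · exact Or.inr (h _ hj)
    · refine Or.inl (Set.disjoint_left.2 fun x hx hxj => hj ?_)
      obtain ⟨e, he, hxe⟩ := Set.mem_iUnion₂.1 (hS hx)
      exact hE e he ⟨x, hxj, hxe⟩
  have hcont : ∀ (E : Set ι) (f : X → InfSphere), (∀ e ∈ E, D e ⊆ E) →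
      (∀ e ∈ E, ContinuousOn f (cc e)) → ContinuousOn f (⋃ e ∈ E, cc e) := by
    intro E f hE hf
    rw [continuousOn_iff_isClosed]
    intro T hT
    refine ⟨f ⁻¹' T ∩ ⋃ e ∈ E, cc e, hclosed E hE _ Set.inter_subset_right fun e he => ?_,
      by rw [Set.inter_assoc, Set.inter_self]⟩
    have h1 : (f ⁻¹' T ∩ ⋃ e ∈ E, cc e) ∩ cc e = cc e ∩ f ⁻¹' T := by
      rw [Set.inter_assoc, Set.inter_eq_right.2 (Set.subset_biUnion_of_mem he), Set.inter_comm]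
    rw [h1]
    exact (hf e he).preimage_isClosed_of_isClosed isClosed_closedCell hT
  have hZclosed : ∀ E : Set ι, (∀ e ∈ E, D e ⊆ E) → IsClosed (⋃ e ∈ E, cc e) := by
    intro E hE
    refine hclosed E hE _ subset_rfl fun e he => ?_
    rw [Set.inter_eq_right.2 (Set.subset_biUnion_of_mem he)]
    exact isClosed_closedCell
  have hX : ∀ x, x ∈ ⋃ e ∈ (Set.univ : Set ι), cc e := by
    intro x
    obtain ⟨e, he⟩ := hcover x
    exact Set.mem_iUnion₂.2 ⟨e, trivial, openCell_subset_closedCell _ _ he⟩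
  obtain ⟨g, hg, -⟩ := exists_extension_of_step (Y := InfSphere)
    -- The involution need not permute the cells, so the pieces are closed cells together with their
    -- translates, which are compact and invariant.
    (fun e => cc e ∪ τ.toMap ⁻¹' cc e) D
    (fun e f => ContinuousOn f (cc e) ∧ ∀ x ∈ cc e ∪ τ.toMap ⁻¹' cc e,
      f (τ.toMap x) = antipodalInf.toMap (f x))
    (by
      rintro e f g hfg ⟨h1, h2⟩
      refine ⟨h1.congr (hfg.symm.mono Set.subset_union_left), fun x hx => ?_⟩
      have hx' : τ.toMap x ∈ cc e ∪ τ.toMap ⁻¹' cc e := by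
        rcases hx with hx | hx
        · refine Or.inr ?_
          rwa [Set.mem_preimage, τ.involutive]
        · exact Or.inl hx
      rw [← hfg hx, ← hfg hx']
      exact h2 x hx)
    (by
      intro E f hD hG hE
      obtain ⟨e, he, hmin⟩ : ∃ e, e ∉ E ∧ ∀ e' : ι, e'.1 < e.1 → e' ∈ E := by
        obtain ⟨a, ha⟩ := (Set.ne_univ_iff_exists_notMem E).1 hE
        obtain ⟨s, hs, hm⟩ := exists_minimalFor_of_wellFoundedLT (· ∉ E)
          (fun s : ι => s.1) ⟨a, ha⟩
        refine ⟨s, hs, fun t ht => ?_⟩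
        by_contra h
        exact absurd (hm h ht.le) (not_le.2 ht)
      let Z : Set X := ⋃ e ∈ E, cc e
      have hZ : IsClosed Z := hZclosed E hD
      have hZ' : IsClosed (τ.toMap ⁻¹' Z) := hZ.preimage τ.toMap.continuous
      have hodd : ∀ x ∈ Z ∪ τ.toMap ⁻¹' Z, f (τ.toMap x) = antipodalInf.toMap (f x) := by
        rintro x (hx | hx)
        · obtain ⟨i, hi, hxi⟩ := Set.mem_iUnion₂.1 hx
          exact (hG i hi).2 x (Or.inl hxi)
        · obtain ⟨i, hi, hxi⟩ := Set.mem_iUnion₂.1 hx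
          exact (hG i hi).2 x (Or.inr hxi)
      have hfZ : ContinuousOn f Z := hcont E f hD fun i hi => (hG i hi).1
      have hfA : ContinuousOn f (Z ∪ τ.toMap ⁻¹' Z) := by
        refine hfZ.union_of_isClosed ?_ hZ hZ'
        refine ((antipodalInf.toMap.continuous.comp_continuousOn
          (hfZ.comp τ.toMap.continuous.continuousOn fun x hx => hx))).congr fun x hx => ?_
        show f x = antipodalInf.toMap (f (τ.toMap x))
        rw [hodd x (Or.inr hx), antipodalInf.involutive]
      let B : Set X := cc e ∪ τ.toMap ⁻¹' cc e
      have hBτ : ∀ x ∈ B, τ.toMap x ∈ B := by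
        rintro x (hx | hx)
        · refine Or.inr ?_
          rwa [Set.mem_preimage, τ.involutive]
        · exact Or.inl hx
      have hB : IsCompact B := by
        refine isCompact_closedCell.union ?_
        rw [← τ.involutive.image_eq_preimage_symm]
        exact isCompact_closedCell.image τ.toMap.continuous
      have hBc : CompactSpace B := isCompact_iff_compactSpace.1 hB
      let τB : FreeInvolution B :=
        { toMap := ⟨fun x => ⟨τ.toMap x.1, hBτ x.1 x.2⟩,
            (τ.toMap.continuous.comp continuous_subtype_val).subtype_mk _⟩
          involutive := fun x => Subtype.ext (τ.involutive x.1)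
          free := fun x h => τ.free x.1 (congrArg Subtype.val h) }
      obtain ⟨g, hg⟩ := exists_equivMap_antipodalInf_extending τB
        (A := Subtype.val ⁻¹' (Z ∪ τ.toMap ⁻¹' Z))
        ((hZ.union hZ').preimage continuous_subtype_val) (by
          rintro x (hx | hx)
          · refine Or.inr ?_
            show τ.toMap (τ.toMap x.1) ∈ Z
            rwa [τ.involutive]
          · exact Or.inl hx) (fun x => f x.1)
        (hfA.comp continuous_subtype_val.continuousOn fun x hx => hx)
        (fun x hx => hodd x.1 hx)
      let F : X → InfSphere := fun x => if h : x ∈ B then g.toMap ⟨x, h⟩ else f x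
      have hFB : ∀ x (h : x ∈ B), F x = g.toMap ⟨x, h⟩ := fun x h => dif_pos h
      have hFf : ∀ x ∈ Z ∪ τ.toMap ⁻¹' Z, f x = F x := by
        intro x hx
        by_cases h : x ∈ B
        · rw [hFB x h]
          exact hg (x := ⟨x, h⟩) hx
        · have h1 : F x = f x := dif_neg h
          exact h1.symm
      have hPZ : ∀ i ∈ E, cc i ∪ τ.toMap ⁻¹' cc i ⊆ Z ∪ τ.toMap ⁻¹' Z := fun i hi =>
        Set.union_subset_union (Set.subset_biUnion_of_mem hi)
          (Set.preimage_mono (Set.subset_biUnion_of_mem (u := cc) hi))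
      refine ⟨insert e E, F, Set.ssubset_insert he, ?_, ?_, fun i hi x hx => hFf x (hPZ i hi hx)⟩
      · rintro i (rfl | hi)
        · rintro j ⟨x, hxj, hxi⟩
          -- The frontier of the new cell is covered by open cells of lower dimension, which lie in
          -- `E` by minimality.
          have hxi' : x ∈ cellFrontier i.1 i.2 ∪ openCell i.1 i.2 := by
            rw [cellFrontier_union_openCell_eq_closedCell]
            exact hxi
          rcases hxi' with hx | hx
          · obtain ⟨I, hI⟩ := cellFrontier_subset_finite_openCell i.1 i.2
            have := hI hx
            simp only [Set.mem_iUnion] at this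
            obtain ⟨m, hm, c, -, hxc⟩ := this
            have hj : j = ⟨m, c⟩ := hdisj hxj hxc
            exact Or.inr (hmin j (by rw [hj]; exact hm))
          · exact Or.inl (hdisj hxj hx)
        · exact (hD i hi).trans (Set.subset_insert e E)
      · rintro i (rfl | hi)
        · constructor
          · rw [continuousOn_iff_continuous_domRestrict]
            refine (g.toMap.continuous.comp (continuous_subtype_val.subtype_mk
              fun x : cc i => Or.inl x.2)).congr fun x => ?_
            exact (hFB x.1 (Or.inl x.2)).symm
          · intro x hx
            rw [hFB x hx, hFB _ (hBτ x hx)]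
            exact g.map_inv ⟨x, hx⟩
        · refine ⟨(hG i hi).1.congr fun x hx => (hFf x (hPZ i hi (Or.inl hx))).symm,
            fun x hx => ?_⟩
          have hx' : τ.toMap x ∈ Z ∪ τ.toMap ⁻¹' Z := by
            rcases hPZ i hi hx with h | h
            · refine Or.inr ?_
              rwa [Set.mem_preimage, τ.involutive]
            · exact Or.inl h
          rw [← hFf x (hPZ i hi hx), ← hFf _ hx']
          exact (hG i hi).2 x hx)
    ∅ (fun _ => InfSphere.normalize 1 (fun _ => 1) (by simp)) (by simp) (by simp)
  refine ⟨⟨⟨g, ?_⟩, fun x => ?_⟩⟩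
  · rw [← continuousOn_univ]
    exact (hcont Set.univ g (fun _ _ => Set.subset_univ _) fun e _ => (hg e).1).mono
      fun x _ => hX x
  · obtain ⟨e, he⟩ := hcover x
    exact (hg e).2 x (Or.inl (openCell_subset_closedCell _ _ he))

/-! ### The double covering of the orbit space and lifts of singular simplices. -/

section Covering

variable {X : Type u} [TopologicalSpace X] (τ : FreeInvolution X)

/-- The projection to the orbit space. -/
def FreeInvolution.proj : C(X, τ.Orbit) where
  toFun := Quotient.mk τ.orbitSetoid
  continuous_toFun := continuous_quotient_mk'

variable {τ} in
theorem FreeInvolution.proj_eq_iff {x y : X} :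
    τ.proj x = τ.proj y ↔ y = x ∨ y = τ.toMap x :=
  Quotient.eq (r := τ.orbitSetoid)

theorem FreeInvolution.proj_toMap (x : X) : τ.proj (τ.toMap x) = τ.proj x :=
  (FreeInvolution.proj_eq_iff.2 (Or.inr rfl)).symm

theorem FreeInvolution.proj_surjective : Function.Surjective τ.proj :=
  Quotient.mk_surjective

/-- The action of the group `{1, -1}` given by a free involution. -/
abbrev FreeInvolution.mulAction : MulAction ℤˣ X where
  smul u x := if u = 1 then x else τ.toMap x
  one_smul x := if_pos rfl
  mul_smul u w x := by
    show ite _ _ _ = ite _ (ite _ _ _) (τ.toMap (ite _ _ _))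
    rcases Int.units_eq_one_or u with rfl | rfl <;> rcases Int.units_eq_one_or w with rfl | rfl <;>
      simp [τ.involutive x]

/-- In a Hausdorff space `x` and `τ x` have disjoint neighbourhoods, hence `x` has a neighbourhood
disjoint from its translate. -/
theorem FreeInvolution.isCoveringMap_proj [T2Space X] : IsCoveringMap τ.proj := by
  let := τ.mulAction
  have hone : ∀ x : X, (1 : ℤˣ) • x = x := fun x => one_smul _ x
  have hneg : ∀ x : X, (-1 : ℤˣ) • x = τ.toMap x := fun x => if_neg (by decide)
  have h : IsQuotientCoveringMap τ.proj ℤˣ :=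
    { toIsQuotientMap := isQuotientMap_quotient_mk'
      continuous_const_smul := by
        intro u
        rcases Int.units_eq_one_or u with rfl | rfl
        · simpa only [hone] using continuous_id'
        · simpa only [hneg] using τ.toMap.continuous
      apply_eq_iff_mem_orbit := by
        intro x y
        rw [FreeInvolution.proj_eq_iff]
        constructor
        · rintro (rfl | rfl)
          · exact ⟨1, hone _⟩
          · exact ⟨-1, (hneg _).trans (τ.involutive x)⟩
        · rintro ⟨u, rfl⟩
          rcases Int.units_eq_one_or u with rfl | rfl
          · exact Or.inl (hone y).symm
          · refine Or.inr ?_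
            show y = τ.toMap ((-1 : ℤˣ) • y)
            rw [hneg, τ.involutive]
      disjoint := by
        intro x
        obtain ⟨U, V, hU, hV, hxU, hxV, hUV⟩ := t2_separation (τ.free x).symm
        refine ⟨U ∩ τ.toMap ⁻¹' V, (hU.inter (hV.preimage τ.toMap.continuous)).mem_nhds
          ⟨hxU, hxV⟩, fun u => ?_⟩
        rcases Int.units_eq_one_or u with rfl | rfl
        · exact fun _ => rfl
        · rintro ⟨y, ⟨z, hz, rfl⟩, hy⟩
          have h1 : (-1 : ℤˣ) • z ∈ U := hy.1
          rw [hneg] at h1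
          exact absurd hz.2 (Set.disjoint_left.1 hUV h1) }
  exact h.isCoveringMap

/-- A retraction of the ambient space onto the standard simplex. -/
theorem exists_retraction_stdSimplex (n : ℕ) :
    ∃ r : C(Fin (n + 1) → ℝ, stdSimplex ℝ (Fin (n + 1))), ∀ x, r x.1 = x := by
  let S : (Fin (n + 1) → ℝ) → ℝ := fun x => ∑ i, max (x i) 0
  -- Positive parts are taken, any mass missing from `1` is put on vertex `0`, and the excess is
  -- divided out.
  let w : (Fin (n + 1) → ℝ) → Fin (n + 1) → ℝ := fun x i =>
    (max (x i) 0 + (if i = 0 then max (1 - S x) 0 else 0)) / max (S x) 1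
  have hS : Continuous S := by fun_prop
  have hpos : ∀ x, 0 < max (S x) 1 := fun x => lt_max_of_lt_right one_pos
  have hw : Continuous w := by
    refine continuous_pi fun i => Continuous.div ?_ (hS.max continuous_const)
      fun x => (hpos x).ne'
    split_ifs <;> fun_prop
  refine ⟨⟨fun x => ⟨w x, fun i => ?_, ?_⟩, hw.subtype_mk _⟩, fun x => ?_⟩
  · refine div_nonneg (add_nonneg (le_max_right _ _) ?_) (hpos x).le
    split_ifs
    · exact le_max_right _ _
    · exact le_rfl
  · rw [← Finset.sum_div, div_eq_one_iff_eq (hpos x).ne', Finset.sum_add_distrib,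
      Finset.sum_ite_eq' Finset.univ, if_pos (Finset.mem_univ _)]
    show S x + _ = _
    rcases le_total (S x) 1 with h | h
    · rw [max_eq_left (by linarith), max_eq_right h]
      ring
    · rw [max_eq_right (by linarith), max_eq_left h, add_zero]
  · have h0 : ∀ i, max (x.1 i) 0 = x.1 i := fun i => max_eq_left (x.2.1 i)
    have h1 : S x.1 = 1 := (Finset.sum_congr rfl fun i _ => h0 i).trans x.2.2
    refine Subtype.ext (funext fun i => ?_)
    show w x.1 i = x.1 i
    simp [w, h1, h0]

/-- Singular simplices of the orbit space lift. -/
theorem FreeInvolution.exists_lift [T2Space X] {n : ℕ} (s : SingSimplex n τ.Orbit) :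
    ∃ t : SingSimplex n X, τ.proj.comp t = s := by
  -- The simplex extends to the whole vector space, which is simply connected and locally path
  -- connected, so the lifting criterion applies there.
  obtain ⟨r, hr⟩ := exists_retraction_stdSimplex n
  obtain ⟨e, he⟩ := τ.proj_surjective (s (r 0))
  obtain ⟨F, ⟨-, hF⟩, -⟩ := τ.isCoveringMap_proj.existsUnique_continuousMap_lifts
    (s.comp r) 0 e he
  refine ⟨F.comp ⟨Subtype.val, continuous_subtype_val⟩, ?_⟩
  ext x
  refine (congrFun hF x.1).trans ?_
  exact congrArg s (hr x)

/-- Lifts on a connected simplex are determined by one value, and over a given point there are only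
two values. -/
theorem FreeInvolution.eq_or_eq_of_proj_comp_eq [T2Space X] {n : ℕ} {s t : SingSimplex n X}
    (h : τ.proj.comp s = τ.proj.comp t) : t = s ∨ t = τ.toMap.comp s := by
  have h0 : ∀ x, τ.proj (s x) = τ.proj (t x) := fun x => DFunLike.congr_fun h x
  obtain ⟨x⟩ : Nonempty (stdSimplex ℝ (Fin (n + 1))) := inferInstance
  rcases FreeInvolution.proj_eq_iff.1 (h0 x) with h1 | h1
  · refine Or.inl (DFunLike.coe_injective ?_)
    exact τ.isCoveringMap_proj.eq_of_comp_eq t.continuous s.continuous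
      (funext fun y => (h0 y).symm) x h1
  · refine Or.inr (DFunLike.coe_injective ?_)
    refine τ.isCoveringMap_proj.eq_of_comp_eq t.continuous (τ.toMap.comp s).continuous
      (funext fun y => ?_) x h1
    exact (h0 y).symm.trans (τ.proj_toMap _).symm

end Covering

/-! ### The infinite sphere is contractible -/

namespace InfSphere

/-- Makes the contraction independent of the bound chosen for the support of each point. -/
theorem normalize_eq_of_le {m n : ℕ} (hmn : m ≤ n) (v : ℕ → ℝ) (h0 : ∀ i, m ≤ i → v i = 0)
    (hm : 0 < ∑ i ∈ Finset.range m, v i ^ 2) (hn : 0 < ∑ i ∈ Finset.range n, v i ^ 2) :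
    normalize m v hm = normalize n v hn := by
  have hsum : ∑ i ∈ Finset.range m, v i ^ 2 = ∑ i ∈ Finset.range n, v i ^ 2 :=
    Finset.sum_subset (Finset.range_mono hmn) fun i _ hi => by
      rw [h0 i (by simpa using hi)]
      simp
  refine Subtype.ext (Finsupp.ext fun i => ?_)
  rw [normalize_apply, normalize_apply, hsum]
  by_cases h : m ≤ i
  · simp [h0 i h]
  · rw [if_pos (by omega), if_pos (by omega)]

theorem normalize_eq_self {n : ℕ} {v : ℕ → ℝ} (x : InfSphere) (hx : x.1.support ⊆ Finset.range n)
    (hv : ∀ i, v i = x.1 i) (h : 0 < ∑ i ∈ Finset.range n, v i ^ 2) : normalize n v h = x := by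
  refine Subtype.ext (Finsupp.ext fun i => ?_)
  simp only [normalize_apply, hv, sum_sq_eq_one x hx, Real.sqrt_one, div_one]
  split_ifs with h1
  · rfl
  · by_contra h2
    exact h1 (Finset.mem_range.1 (hx (Finsupp.mem_support_iff.2 fun h3 => h2 h3.symm)))

/-- The coordinates of a path from `x` to the first basis vector, by way of the shift of `x`. -/
def contractionCoords (x : InfSphere) (t : ℝ) (i : ℕ) : ℝ :=
  (1 - t) ^ 2 * x.1 i + t * (1 - t) * (if i = 0 then 0 else x.1 (i - 1))
    + t ^ 2 * (if i = 0 then 1 else 0)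

theorem contractionCoords_eq_zero {x : InfSphere} {n : ℕ} (hx : x.1.support ⊆ Finset.range n)
    (t : ℝ) {i : ℕ} (hi : n + 1 ≤ i) : contractionCoords x t i = 0 := by
  have h0 : ∀ j, n ≤ j → x.1 j = 0 := fun j hj => by
    by_contra h
    exact absurd (Finset.mem_range.1 (hx (Finsupp.mem_support_iff.2 h))) (by omega)
  have hi0 : i ≠ 0 := by omega
  simp [contractionCoords, h0 i (by omega), h0 (i - 1) (by omega), hi0]

/-- The detour through the shift keeps the path away from zero: for `t ≠ 0, 1`, if `m` is the last
index in the support of `x`, then coordinate `m + 1` equals `t(1 - t) x_m`. -/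
theorem sum_contractionCoords_pos {x : InfSphere} {n : ℕ} (hx : x.1.support ⊆ Finset.range n)
    (t : ℝ) : 0 < ∑ i ∈ Finset.range (n + 1), contractionCoords x t i ^ 2 := by
  obtain ⟨j, hj⟩ : x.1.support.Nonempty := by
    rw [Finset.nonempty_iff_ne_empty]
    intro h
    have := x.2
    rw [h] at this
    simp at this
  have hex : ∃ i < n + 1, contractionCoords x t i ≠ 0 := by
    by_cases h0 : t = 0
    · have := Finset.mem_range.1 (hx hj)
      refine ⟨j, by omega, ?_⟩
      simpa [contractionCoords, h0] using hj
    by_cases h1 : t = 1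
    · exact ⟨0, by omega, by simp [contractionCoords, h1]⟩
    have hne : x.1.support.Nonempty := ⟨j, hj⟩
    have hmax := x.1.support.max'_mem hne
    have hmax' : x.1 (x.1.support.max' hne + 1) = 0 := by
      by_contra h
      have := x.1.support.le_max' _ (Finsupp.mem_support_iff.2 h)
      omega
    have := Finset.mem_range.1 (hx hmax)
    refine ⟨x.1.support.max' hne + 1, by omega, ?_⟩
    have h3 : 1 - t ≠ 0 := sub_ne_zero.2 (Ne.symm h1)
    simp only [contractionCoords, hmax', Nat.add_sub_cancel]
    simpa [h0, h3] using hmax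
  obtain ⟨i, hi, hne⟩ := hex
  exact Finset.sum_pos' (fun _ _ => sq_nonneg _) ⟨i, Finset.mem_range.2 hi, by positivity⟩

theorem exists_support_subset (x : InfSphere) : ∃ n, x.1.support ⊆ Finset.range n := by
  obtain ⟨n, hn⟩ := x.1.support.exists_nat_subset_range
  exact ⟨n, hn⟩

/-- There is a contraction of `S^∞`, which is continuous on compact families. -/
theorem exists_contraction : ∃ (H : InfSphere → ℝ → InfSphere) (x₀ : InfSphere),
    (∀ x, H x 0 = x) ∧ (∀ x, H x 1 = x₀) ∧
      ∀ {A : Type u} [TopologicalSpace A] [CompactSpace A] (s : A → InfSphere) (t : A → ℝ),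
        Continuous s → Continuous t → Continuous fun a => H (s a) (t a) := by
  choose N hN using exists_support_subset
  let H : InfSphere → ℝ → InfSphere := fun x t =>
    normalize (N x + 1) (contractionCoords x t) (sum_contractionCoords_pos (hN x) t)
  have hH : ∀ (x : InfSphere) (t : ℝ) (n : ℕ) (hn : x.1.support ⊆ Finset.range n), H x t
      = normalize (n + 1) (contractionCoords x t) (sum_contractionCoords_pos hn t) := by
    intro x t n hn
    rcases le_total (N x) n with h | h
    · exact normalize_eq_of_le (by omega) _ (fun i hi => contractionCoords_eq_zero (hN x) t hi) _ _
    · exact (normalize_eq_of_le (by omega) _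
        (fun i hi => contractionCoords_eq_zero hn t hi) _ _).symm
  refine ⟨H, normalize 1 (fun _ => 1) (by simp), fun x => ?_, fun x => ?_, ?_⟩
  · refine normalize_eq_self x ((hN x).trans (Finset.range_mono (Nat.le_succ _))) (fun i => ?_) _
    simp [contractionCoords]
  · refine Subtype.ext (Finsupp.ext fun i => ?_)
    have hsum : ∑ i ∈ Finset.range (N x + 1), contractionCoords x 1 i ^ 2 = 1 := by
      rw [Finset.sum_eq_single 0 (fun i _ hi => by simp [contractionCoords, hi])
        (fun h => absurd (Finset.mem_range.2 (Nat.succ_pos _)) h)]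
      simp [contractionCoords]
    rw [normalize_apply, normalize_apply, hsum]
    by_cases h : i = 0
    · simp [contractionCoords, h]
    · simp [contractionCoords, h]
  · intro A _ _ s t hs ht
    -- Compactness puts the whole family in one subsphere, where a single normalization formula is
    -- valid.
    obtain ⟨n, hn⟩ := exists_support_subset_of_isCompact (isCompact_range hs)
    have hn' : ∀ a, (s a).1.support ⊆ Finset.range n := fun a => hn _ ⟨a, rfl⟩
    have h1 := continuous_normalize (A := A) (n := n + 1)
      (v := fun a => contractionCoords (s a) (t a))
      (fun a => sum_contractionCoords_pos (hn' a) (t a)) (by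
        intro i
        have h2 : ∀ j, Continuous fun a => (s a).1 j := fun j => (continuous_coord j).comp hs
        unfold contractionCoords
        split_ifs
        · have := h2 i
          fun_prop
        · have := h2 i
          have := h2 (i - 1)
          fun_prop)
    exact h1.congr fun a => (hH (s a) (t a) n (hn' a)).symm

end InfSphere

/-! ### Cochains in low degree. -/

section Cochains

variable {X : Type u} {Y : Type v} [TopologicalSpace X] [TopologicalSpace Y]

theorem coboundary_apply (n : ℕ) (a : Cochain n X) (s : SingSimplex (n + 1) X) :
    coboundary n X a s = ∑ i : Fin (n + 2), a (SingSimplex.reindex s i.succAbove) := rfl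

theorem cochainMap_apply (n : ℕ) (f : C(X, Y)) (a : Cochain n Y) (s : SingSimplex n X) :
    cochainMap n f a s = a (f.comp s) := rfl

theorem SingSimplex.reindex_id {n : ℕ} (s : SingSimplex n X) : SingSimplex.reindex s id = s := by
  ext x
  exact congrArg s (stdSimplex.map_id_apply x)

theorem SingSimplex.comp_reindex {m n : ℕ} (g : C(X, Y)) (s : SingSimplex n X)
    (f : Fin (m + 1) → Fin (n + 1)) :
    SingSimplex.reindex (g.comp s) f = g.comp (SingSimplex.reindex s f) := rfl

theorem two_eq_zero_zmod : (2 : ZMod 2) = 0 := by decide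

theorem coboundary_zero_apply (a : Cochain 0 X) (s : SingSimplex 1 X) :
    coboundary 0 X a s
      = a (SingSimplex.reindex s fun _ => 0) + a (SingSimplex.reindex s fun _ => 1) := by
  rw [coboundary_apply, Fin.sum_univ_two, add_comm]
  have h0 : (0 : Fin 2).succAbove = fun _ => 1 := by decide
  have h1 : (1 : Fin 2).succAbove = fun _ => 0 := by decide
  rw [h0, h1]

theorem coboundary_one_apply (a : Cochain 1 X) (s : SingSimplex 2 X) :
    coboundary 1 X a s = a (SingSimplex.reindex s ![1, 2]) + a (SingSimplex.reindex s ![0, 2])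
      + a (SingSimplex.reindex s ![0, 1]) := by
  have h0 : (0 : Fin 3).succAbove = ![1, 2] := by decide
  have h1 : (1 : Fin 3).succAbove = ![0, 2] := by decide
  have h2 : (2 : Fin 3).succAbove = ![0, 1] := by decide
  rw [coboundary_apply, Fin.sum_univ_three, h0, h1, h2]

theorem coboundary_coboundary_zero (a : Cochain 0 X) :
    coboundary 1 X (coboundary 0 X a) = 0 := by
  funext s
  simp only [coboundary_one_apply, coboundary_zero_apply, SingSimplex.reindex_reindex]
  have h : ∀ (f : Fin 2 → Fin 3) (i : Fin 2),
      (f ∘ fun _ : Fin 1 => i) = fun _ : Fin 1 => f i := fun _ _ => rfl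
  simp only [h, Matrix.cons_val_zero, Matrix.cons_val_one, Pi.zero_apply]
  linear_combination (a (SingSimplex.reindex s fun _ => 0) + a (SingSimplex.reindex s fun _ => 1)
    + a (SingSimplex.reindex s fun _ => 2)) * two_eq_zero_zmod

theorem cohomology_mk_eq_zero_iff {n : ℕ} (a : cocycles n X) :
    (Submodule.Quotient.mk a : Cohomology n X) = 0 ↔ a.1 ∈ coboundaries n X := by
  rw [Submodule.Quotient.mk_eq_zero]
  rfl

end Cochains

/-! ### Cohomology of the infinite sphere in degrees zero and one. -/

namespace InfSphere

/-- The prism operator of a contraction. -/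
theorem exists_prism : ∃ (x₀ : InfSphere)
    (Q : ∀ m n : ℕ, SingSimplex m InfSphere → (Fin (n + 1) → Fin (m + 1)) →
      (Fin (n + 1) → Fin 2) → SingSimplex n InfSphere),
    (∀ (m n l : ℕ) (s : SingSimplex m InfSphere) (g : Fin (n + 1) → Fin (m + 1))
      (h : Fin (n + 1) → Fin 2) (f : Fin (l + 1) → Fin (n + 1)),
      SingSimplex.reindex (Q m n s g h) f = Q m l s (g ∘ f) (h ∘ f)) ∧
    (∀ (m n : ℕ) (s : SingSimplex m InfSphere) (g : Fin (n + 1) → Fin (m + 1)),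
      Q m n s g (fun _ => 0) = SingSimplex.reindex s g) ∧
    (∀ (m n : ℕ) (s : SingSimplex m InfSphere) (g : Fin (n + 1) → Fin (m + 1)),
      Q m n s g (fun _ => 1) = ContinuousMap.const _ x₀) ∧
    (∀ (m n l : ℕ) (s : SingSimplex m InfSphere) (f : Fin (l + 1) → Fin (m + 1))
      (g : Fin (n + 1) → Fin (l + 1)) (h : Fin (n + 1) → Fin 2),
      Q l n (SingSimplex.reindex s f) g h = Q m n s (f ∘ g) h) := by
  obtain ⟨H, x₀, H0, H1, Hc⟩ := exists_contraction
  have hcont : ∀ (n : ℕ) (h : Fin (n + 1) → Fin 2),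
      Continuous fun x : stdSimplex ℝ (Fin (n + 1)) => stdSimplex.map h x 1 := fun n h =>
    (continuous_apply 1).comp (continuous_subtype_val.comp (stdSimplex.continuous_map h))
  have hconst : ∀ (n : ℕ) (i : Fin 2) (x : stdSimplex ℝ (Fin (n + 1))),
      stdSimplex.map (fun _ => i) x 1 = if i = 1 then 1 else 0 := by
    intro n i x
    rw [stdSimplex.map_coe, FunOnFinite.linearMap_apply_apply]
    split_ifs with h
    · simp [h]
    · simp [h]
  -- `Q` restricts the homotopy on the prism `Δ^m × [0,1]` to the affine simplex with vertices `(g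
  -- i, h i)`.
  refine ⟨x₀, fun m n s g h => ⟨fun x => H (s (stdSimplex.map g x)) (stdSimplex.map h x 1),
    Hc _ _ (s.continuous.comp (stdSimplex.continuous_map g)) (hcont n h)⟩, ?_, ?_, ?_, ?_⟩
  · intro m n l s g h f
    ext1 x
    show H (s (stdSimplex.map g (stdSimplex.map f x))) (stdSimplex.map h (stdSimplex.map f x) 1)
      = H (s (stdSimplex.map (g ∘ f) x)) (stdSimplex.map (h ∘ f) x 1)
    rw [stdSimplex.map_comp_apply, stdSimplex.map_comp_apply]
  · intro m n s g
    ext1 x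
    show H (s (stdSimplex.map g x)) (stdSimplex.map (fun _ => 0) x 1) = s (stdSimplex.map g x)
    rw [hconst, if_neg (by decide), H0]
  · intro m n s g
    ext1 x
    show H (s (stdSimplex.map g x)) (stdSimplex.map (fun _ => 1) x 1) = x₀
    rw [hconst, if_pos rfl, H1]
  · intro m n l s f g h
    ext1 x
    show H (s (stdSimplex.map f (stdSimplex.map g x))) _ = H (s (stdSimplex.map (f ∘ g) x)) _
    rw [stdSimplex.map_comp_apply]

/-- A `0`-cocycle of the infinite sphere is constant. -/
theorem eq_of_coboundary_eq_zero {a : Cochain 0 InfSphere} (ha : coboundary 0 InfSphere a = 0)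
    (s t : SingSimplex 0 InfSphere) : a s = a t := by
  obtain ⟨x₀, Q, hQ, hQ0, hQ1, -⟩ := exists_prism
  have key : ∀ s, a s = a (ContinuousMap.const _ x₀) := by
    intro s
    have h := congrFun ha (Q 0 1 s (fun _ => 0) ![0, 1])
    rw [coboundary_zero_apply, hQ, hQ] at h
    have h0 : (![0, 1] ∘ fun _ : Fin 1 => (0 : Fin 2)) = fun _ => (0 : Fin 2) := rfl
    have h1 : (![0, 1] ∘ fun _ : Fin 1 => (1 : Fin 2)) = fun _ => (1 : Fin 2) := rfl
    have h2 : ∀ f : Fin (0 + 1) → Fin (0 + 1), f = id := fun f => funext fun i =>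
      Subsingleton.elim (α := Fin 1) _ _
    rw [h0, h1, hQ0, hQ1, h2 (_ ∘ _), SingSimplex.reindex_id] at h
    exact CharTwo.add_eq_zero.1 h
  rw [key s, key t]

/-- A `1`-cocycle of the infinite sphere is a coboundary. -/
theorem exists_coboundary_eq {c : Cochain 1 InfSphere} (hc : coboundary 1 InfSphere c = 0) :
    ∃ η : Cochain 0 InfSphere, coboundary 0 InfSphere η = c := by
  obtain ⟨x₀, Q, hQ, hQ0, hQ1, hQr⟩ := exists_prism
  -- The primitive at a point is the value of `c` on its track under the contraction.
  refine ⟨fun p => c (Q 0 1 p (fun _ => 0) ![0, 1]), ?_⟩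
  funext s
  rw [coboundary_zero_apply, hQr, hQr]
  -- The three edges of a constant triangle coincide, and `3 = 1` modulo 2.
  have hconst : c (ContinuousMap.const _ x₀) = 0 := by
    have h := congrFun hc (ContinuousMap.const _ x₀)
    have h1 : ∀ f : Fin (1 + 1) → Fin (2 + 1), SingSimplex.reindex
        (ContinuousMap.const _ x₀ : SingSimplex 2 InfSphere) f = ContinuousMap.const _ x₀ :=
      fun f => rfl
    rw [coboundary_one_apply, h1, h1, h1, Pi.zero_apply] at h
    linear_combination h - c (ContinuousMap.const _ x₀) * two_eq_zero_zmod
  -- These two triangles subdivide the square over `s`. Their common diagonal cancels modulo 2,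
  -- leaving the edge `s`, the tracks of its endpoints and the constant top edge.
  have h1 := congrFun hc (Q 1 2 s ![0, 1, 1] ![0, 0, 1])
  have h2 := congrFun hc (Q 1 2 s ![0, 0, 1] ![0, 1, 1])
  rw [coboundary_one_apply, hQ, hQ, hQ, Pi.zero_apply] at h1 h2
  have e1 : ![(0 : Fin 2), 1, 1] ∘ ![(1 : Fin 3), 2] = fun _ => 1 := by decide
  have e2 : ![(0 : Fin 2), 0, 1] ∘ ![(1 : Fin 3), 2] = ![0, 1] := by decide
  have e3 : ![(0 : Fin 2), 1, 1] ∘ ![(0 : Fin 3), 2] = ![0, 1] := by decide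
  have e4 : ![(0 : Fin 2), 0, 1] ∘ ![(0 : Fin 3), 2] = ![0, 1] := by decide
  have e5 : ![(0 : Fin 2), 1, 1] ∘ ![(0 : Fin 3), 1] = ![0, 1] := by decide
  have e6 : ![(0 : Fin 2), 0, 1] ∘ ![(0 : Fin 3), 1] = fun _ => 0 := by decide
  have e7 : (![0, 1] : Fin 2 → Fin 2) = id := by decide
  rw [e1, e2, e3, e4, e5, e6, hQ0] at h1
  rw [e1, e2, e3, e4, e5, e6, hQ1, hconst] at h2
  have e8 : SingSimplex.reindex s ![0, 1] = s := by
    rw [e7, SingSimplex.reindex_id]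
  rw [e8] at h1
  have e9 : ∀ i : Fin 2, ((fun _ : Fin 1 => i) ∘ fun _ : Fin 2 => (0 : Fin 1)) = fun _ => i :=
    fun _ => rfl
  rw [e9, e9]
  linear_combination h1 + h2 - (c s + c (Q 1 1 s ![0, 1] ![0, 1])) * two_eq_zero_zmod

end InfSphere

/-! ### The first cohomology of infinite projective space. -/

/-- The pullback to `S^∞` of a cocycle of `RP^∞` which is not a coboundary is the coboundary of a
cochain which is not invariant. -/
theorem exists_cochain_of_not_mem_coboundaries {c : Cochain 1 RPInf}
    (hc : coboundary 1 RPInf c = 0) (hne : c ∉ coboundaries 1 RPInf) :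
    ∃ η : Cochain 0 InfSphere, coboundary 0 InfSphere η = cochainMap 1 antipodalInf.proj c ∧
      ∀ s, η (antipodalInf.toMap.comp s) = η s + 1 := by
  obtain ⟨η, hη⟩ := InfSphere.exists_coboundary_eq
    (c := cochainMap 1 antipodalInf.proj c) (by rw [coboundary_cochainMap, hc, map_zero])
  refine ⟨η, hη, ?_⟩
  have hproj : ∀ {n : ℕ} (s : SingSimplex n InfSphere),
      antipodalInf.proj.comp (antipodalInf.toMap.comp s) = antipodalInf.proj.comp s := fun s =>
    ContinuousMap.ext fun x => antipodalInf.proj_toMap (s x)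
  -- The pulled back cocycle is invariant under the antipode, so `η` and its translate have equal
  -- coboundaries and differ by a constant.
  have hconst : coboundary 0 InfSphere (η + cochainMap 0 antipodalInf.toMap η) = 0 := by
    rw [map_add, coboundary_cochainMap, hη]
    funext s
    rw [Pi.add_apply, cochainMap_apply, cochainMap_apply, cochainMap_apply, hproj]
    exact CharTwo.add_self_eq_zero _
  obtain ⟨r, hr⟩ : ∃ r, ∀ s, (η + cochainMap 0 antipodalInf.toMap η) s = r :=
    ⟨_, fun s => InfSphere.eq_of_coboundary_eq_zero hconst s
      (ContinuousMap.const _ (InfSphere.normalize 1 (fun _ => 1) (by simp)))⟩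
  replace hr : ∀ s, η s + η (antipodalInf.toMap.comp s) = r := hr
  have h01 : ∀ r : ZMod 2, r = 0 ∨ r = 1 := by decide
  rcases h01 r with rfl | rfl
  -- If the constant is `0`, then `η` is invariant and descends to a primitive of `c`.
  · refine absurd ?_ hne
    choose lift hlift using fun s : SingSimplex 0 RPInf => antipodalInf.exists_lift s
    have hinv : ∀ s, η (lift (antipodalInf.proj.comp s)) = η s := by
      intro s
      rcases antipodalInf.eq_or_eq_of_proj_comp_eq (hlift (antipodalInf.proj.comp s)).symm
        with h | h
      · rw [h]
      · rw [h]
        exact (CharTwo.add_eq_zero.1 (hr s)).symm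
    refine ⟨fun s => η (lift s), ?_⟩
    funext s
    obtain ⟨t, rfl⟩ := antipodalInf.exists_lift s
    rw [coboundary_zero_apply, SingSimplex.comp_reindex, SingSimplex.comp_reindex, hinv, hinv,
      ← coboundary_zero_apply, hη]
    rfl
  · intro s
    linear_combination hr s - η s * two_eq_zero_zmod

/-- The first cohomology of `RP^∞` is nontrivial. -/
theorem exists_cohomology_ne_zero : ∃ z : Cohomology 1 RPInf, z ≠ 0 := by
  classical
  let p := antipodalInf.proj
  -- A discontinuous selection of one point in each orbit. Singular cochains need no continuity, and
  -- the coboundary of this selection is invariant, so it descends to a cocycle `c`.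
  let ε : InfSphere → ZMod 2 := fun x => if (p x).out = x then 0 else 1
  have hε : ∀ x, ε (antipodalInf.toMap x) = ε x + 1 := by
    intro x
    have hp : p (antipodalInf.toMap x) = p x := antipodalInf.proj_toMap x
    have hout : (p x).out = x ∨ (p x).out = antipodalInf.toMap x :=
      FreeInvolution.proj_eq_iff.1 (Quotient.out_eq (p x)).symm
    have hx : antipodalInf.toMap x ≠ x := antipodalInf.free x
    simp only [ε, hp]
    rcases hout with h | h
    · rw [h, if_neg hx.symm, if_pos rfl]
      decide
    · rw [h, if_pos rfl, if_neg hx]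
      decide
  obtain ⟨pt⟩ : Nonempty (stdSimplex ℝ (Fin (0 + 1))) := inferInstance
  let a : Cochain 0 InfSphere := fun s => ε (s pt)
  have ha : ∀ s, a (antipodalInf.toMap.comp s) = a s + 1 := fun s => hε (s pt)
  choose lift hlift using fun s : SingSimplex 1 RPInf => antipodalInf.exists_lift s
  let c : Cochain 1 RPInf := fun s => coboundary 0 InfSphere a (lift s)
  have hc : ∀ s : SingSimplex 1 InfSphere,
      c (antipodalInf.proj.comp s) = coboundary 0 InfSphere a s := by
    intro s
    show coboundary 0 InfSphere a (lift _) = _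
    rcases antipodalInf.eq_or_eq_of_proj_comp_eq (hlift (antipodalInf.proj.comp s)).symm
      with h | h
    · rw [h]
    · rw [h, coboundary_zero_apply, coboundary_zero_apply, SingSimplex.comp_reindex,
        SingSimplex.comp_reindex, ha, ha]
      linear_combination two_eq_zero_zmod
  have hcc : coboundary 1 RPInf c = 0 := by
    funext s
    obtain ⟨t, rfl⟩ := antipodalInf.exists_lift s
    rw [coboundary_one_apply, SingSimplex.comp_reindex, SingSimplex.comp_reindex,
      SingSimplex.comp_reindex, hc, hc, hc, ← coboundary_one_apply, coboundary_coboundary_zero]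
    rfl
  refine ⟨Submodule.Quotient.mk ⟨c, hcc⟩, fun h => ?_⟩
  obtain ⟨b, hb⟩ : c ∈ coboundaries 1 RPInf := (cohomology_mk_eq_zero_iff _).1 h
  -- A primitive `b` of `c` would make `a` plus the pullback of `b` constant, although it changes by
  -- `1` under the antipode.
  have hab : coboundary 0 InfSphere (a + cochainMap 0 antipodalInf.proj b) = 0 := by
    rw [map_add, coboundary_cochainMap, hb]
    funext s
    rw [Pi.add_apply, cochainMap_apply, hc]
    exact CharTwo.add_self_eq_zero _
  let s : SingSimplex 0 InfSphere :=
    ContinuousMap.const _ (InfSphere.normalize 1 (fun _ => 1) (by simp))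
  have h1 := InfSphere.eq_of_coboundary_eq_zero hab (antipodalInf.toMap.comp s) s
  have h2 : antipodalInf.proj.comp (antipodalInf.toMap.comp s) = antipodalInf.proj.comp s :=
    ContinuousMap.ext fun x => antipodalInf.proj_toMap (s x)
  rw [Pi.add_apply, Pi.add_apply, cochainMap_apply, cochainMap_apply, h2, ha] at h1
  have h3 : (1 : ZMod 2) = 0 := by linear_combination h1
  exact one_ne_zero h3

theorem rpClass_ne_zero : rpClass ≠ 0 :=
  Classical.epsilon_spec (p := fun z : Cohomology 1 RPInf => z ≠ 0) exists_cohomology_ne_zero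

/-! ### Cup powers on the level of cochains. -/

section CupPowers

variable {X : Type u} [TopologicalSpace X]

/-- The cup powers of a cochain of degree one. -/
noncomputable def cochainPow (c : Cochain 1 X) : (k : ℕ) → Cochain k X
  | 0 => fun _ => 1
  | k + 1 => cochainCup rfl (cochainPow c k) c

/-- Iterated front and back faces isolate the edges joining consecutive vertices. -/
theorem cochainPow_apply (c : Cochain 1 X) : ∀ (k : ℕ) (s : SingSimplex k X),
    cochainPow c k s = ∏ i : Fin k, c (SingSimplex.reindex s ![i.castSucc, i.succ])
  | 0, s => by simp [cochainPow]
  | k + 1, s => by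
    rw [Fin.prod_univ_castSucc]
    show cochainPow c k _ * c _ = _
    rw [cochainPow_apply c k]
    simp only [SingSimplex.reindex_reindex]
    have h1 : ∀ i : Fin k, (front rfl : Fin (k + 1) → Fin (k + 1 + 1)) ∘ ![i.castSucc, i.succ]
        = ![i.castSucc.castSucc, i.castSucc.succ] := by
      intro i
      funext j
      fin_cases j <;> rfl
    have h2 : (back rfl : Fin (1 + 1) → Fin (k + 1 + 1))
        = ![(Fin.last k).castSucc, (Fin.last k).succ] := by
      funext j
      fin_cases j <;> rfl
    simp only [h1, h2]

theorem cupPow_mk (c : cocycles 1 X) : ∀ k : ℕ, ∃ a : cocycles k X,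
    a.1 = cochainPow c.1 k ∧ cupPow (Submodule.Quotient.mk c) k = Submodule.Quotient.mk a
  | 0 => ⟨_, rfl, rfl⟩
  | k + 1 => by
    obtain ⟨a, ha, hk⟩ := cupPow_mk c k
    refine ⟨cocycleCup rfl a c, ?_, ?_⟩
    · show cochainCup rfl a.1 c.1 = cochainCup rfl (cochainPow c.1 k) c.1
      rw [ha]
    · show cup rfl (cupPow _ k) _ = _
      rw [hk]
      rfl

end CupPowers

/-! ### The simplices of the boundary of the cross-polytope -/

/-- The sign of an element of `ℤ₂`. -/
noncomputable def sign (a : ZMod 2) : ℝ := if a = 0 then 1 else -1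

theorem sign_add_one : ∀ a : ZMod 2, sign (a + 1) = -sign a := by
  have h : ∀ a : ZMod 2, a = 0 ∨ a = 1 := by decide
  intro a
  rcases h a with rfl | rfl
  · simp [sign]
  · have : (1 : ZMod 2) + 1 = 0 := by decide
    simp [sign, this]

theorem sign_ne_zero (a : ZMod 2) : sign a ≠ 0 := by
  unfold sign
  split_ifs <;> norm_num

/-- The vector with the given signs and absolute values. -/
noncomputable def signedVector {k : ℕ} (σ : Fin (k + 1) → ZMod 2) (x : stdSimplex ℝ (Fin (k + 1))) :
    EuclideanSpace ℝ (Fin (k + 1)) := WithLp.toLp 2 fun i => sign (σ i) * x i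

theorem signedVector_ne_zero {k : ℕ} (σ : Fin (k + 1) → ZMod 2)
    (x : stdSimplex ℝ (Fin (k + 1))) : signedVector σ x ≠ 0 := by
  intro h
  have h1 : ∀ i, x i = 0 := by
    intro i
    have h2 : sign (σ i) * x i = 0 := congrFun (congrArg WithLp.ofLp h) i
    exact (mul_eq_zero.1 h2).resolve_left (sign_ne_zero _)
  have h3 := stdSimplex.sum_eq_one x
  simp [h1] at h3

theorem continuous_signedVector {k : ℕ} (σ : Fin (k + 1) → ZMod 2) :
    Continuous (signedVector σ) := by
  refine (PiLp.continuous_toLp 2 _).comp (continuous_pi fun i => continuous_const.mul ?_)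
  exact (continuous_apply i).comp continuous_subtype_val

/-- The singular simplex of the sphere with vertices `± e_i`. -/
noncomputable def crossSimplex {k : ℕ} (σ : Fin (k + 1) → ZMod 2) :
    SingSimplex k (Metric.sphere (0 : EuclideanSpace ℝ (Fin (k + 1))) 1) where
  toFun x := ⟨‖signedVector σ x‖⁻¹ • signedVector σ x, by
    rw [mem_sphere_zero_iff_norm, norm_smul, norm_inv, norm_norm,
      inv_mul_cancel₀ (norm_ne_zero_iff.2 (signedVector_ne_zero σ x))]⟩
  continuous_toFun := by
    refine Continuous.subtype_mk ?_ _
    exact ((continuous_signedVector σ).norm.inv₀ fun x =>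
      norm_ne_zero_iff.2 (signedVector_ne_zero σ x)).smul (continuous_signedVector σ)

theorem crossSimplex_add_one {k : ℕ} (σ : Fin (k + 1) → ZMod 2) :
    crossSimplex (fun i => σ i + 1) = (antipodal k).toMap.comp (crossSimplex σ) := by
  ext1 x
  have h : signedVector (fun i => σ i + 1) x = -signedVector σ x := by
    ext i
    show sign (σ i + 1) * x i = -(sign (σ i) * x i)
    rw [sign_add_one, neg_mul]
  refine Subtype.ext ?_
  show ‖signedVector (fun i => σ i + 1) x‖⁻¹ • signedVector (fun i => σ i + 1) x
    = -(‖signedVector σ x‖⁻¹ • signedVector σ x)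
  rw [h, norm_neg, smul_neg]

/-- Signs at vertices outside the face multiply zero coordinates. Hence adjacent simplices share
their common facet. -/
theorem crossSimplex_reindex_congr {k m : ℕ} {σ σ' : Fin (k + 1) → ZMod 2}
    {f : Fin (m + 1) → Fin (k + 1)} (h : ∀ i, σ (f i) = σ' (f i)) :
    SingSimplex.reindex (crossSimplex σ) f = SingSimplex.reindex (crossSimplex σ') f := by
  ext1 x
  have h1 : signedVector σ (stdSimplex.map f x) = signedVector σ' (stdSimplex.map f x) := by
    ext j
    show sign (σ j) * stdSimplex.map f x j = sign (σ' j) * stdSimplex.map f x j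
    by_cases hj : ∃ i, f i = j
    · obtain ⟨i, rfl⟩ := hj
      rw [h]
    · have h0 : stdSimplex.map f x j = 0 := by
        rw [stdSimplex.map_coe, FunOnFinite.linearMap_apply_apply]
        exact Finset.sum_eq_zero fun i hi => absurd ⟨i, (Finset.mem_filter.1 hi).2⟩ hj
      rw [h0, mul_zero, mul_zero]
  refine Subtype.ext ?_
  show ‖signedVector σ (stdSimplex.map f x)‖⁻¹ • signedVector σ (stdSimplex.map f x)
    = ‖signedVector σ' (stdSimplex.map f x)‖⁻¹ • signedVector σ' (stdSimplex.map f x)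
  rw [h1]

/-- The image in a quotient of the upper half of the cross-polytope is a cycle. -/
theorem sum_coboundary_crossSimplex {n : ℕ} {Z : Type u} [TopologicalSpace Z]
    (φ : C(Metric.sphere (0 : EuclideanSpace ℝ (Fin (n + 1 + 1))) 1, Z))
    (hφ : φ.comp (antipodal (n + 1)).toMap = φ) (a : Cochain n Z) :
    ∑ σ : Fin (n + 1 + 1) → ZMod 2 with σ (Fin.last _) = 0,
      coboundary n Z a (φ.comp (crossSimplex σ)) = 0 := by
  simp only [coboundary_apply, SingSimplex.comp_reindex]
  rw [Finset.sum_comm]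
  refine Finset.sum_eq_zero fun i _ => ?_
  have h11 : ∀ b : ZMod 2, b + 1 + 1 = b := by decide
  have hne : ∀ b : ZMod 2, b + 1 ≠ b := by decide
  -- Facets cancel in pairs. Those opposite the last vertex lie on the equator and are paired by the
  -- antipode, which `φ` does not see; those opposite another vertex `i` are shared by the two
  -- simplices differing in the sign at `i`.
  by_cases hi : i = Fin.last _
  · subst hi
    have hj : ∀ j, (Fin.last (n + 1)).succAbove j ≠ Fin.last (n + 1) := fun j =>
      Fin.succAbove_ne _ j
    refine Finset.sum_involution (fun σ _ j => if j = Fin.last (n + 1) then σ j else σ j + 1)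
      (fun σ hσ => ?_) (fun σ hσ _ h => ?_) (fun σ hσ => ?_) (fun σ hσ => ?_)
    · rw [crossSimplex_reindex_congr
          (σ := fun j => if j = Fin.last (n + 1) then σ j else σ j + 1)
          (σ' := fun j => σ j + 1) fun j => if_neg (hj j),
        crossSimplex_add_one, SingSimplex.comp_reindex, ← ContinuousMap.comp_assoc, hφ]
      exact CharTwo.add_self_eq_zero _
    · have h0 := congrFun h 0
      rw [if_neg (Fin.last_pos.ne)] at h0
      exact hne _ h0
    · simpa using hσ
    · funext j
      by_cases h : j = Fin.last (n + 1)
      · simp [h]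
      · simp [h, h11]
  · refine Finset.sum_involution (fun σ _ => Function.update σ i (σ i + 1))
      (fun σ hσ => ?_) (fun σ hσ _ h => ?_) (fun σ hσ => ?_) (fun σ hσ => ?_)
    · rw [crossSimplex_reindex_congr (σ := Function.update σ i (σ i + 1)) (σ' := σ) fun j =>
        Function.update_of_ne (Fin.succAbove_ne i j) _ _]
      exact CharTwo.add_self_eq_zero _
    · have h0 := congrFun h i
      rw [Function.update_self] at h0
      exact hne _ h0
    · simpa [Function.update_of_ne (Ne.symm hi)] using hσ
    · simp [h11]

/-- A nonzero product forces the labels `u + σ` to alternate, and the condition on the last sign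
then fixes `σ`. Only one summand survives. -/
theorem sum_prod_add_eq_one (k : ℕ) (u : Fin (k + 1) → ZMod 2) :
    ∑ σ : Fin (k + 1) → ZMod 2 with σ (Fin.last k) = 0,
      ∏ i : Fin k, ((u i.castSucc + σ i.castSucc) + (u i.succ + σ i.succ)) = 1 := by
  have h01 : ∀ b : ZMod 2, b ≠ 0 → b = 1 := by decide
  -- The solution of the alternation condition, read backwards from the last vertex: `u i + σ₀ i`
  -- equals `u (Fin.last k) + (k - i)`.
  let σ₀ : Fin (k + 1) → ZMod 2 := fun i => u i + u (Fin.last k) + ((k - (i : ℕ) : ℕ) : ZMod 2)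
  have hstep : ∀ i : Fin k, (u i.castSucc + σ₀ i.castSucc) + (u i.succ + σ₀ i.succ) = 1 := by
    intro i
    have h1 : (k - (i.castSucc : ℕ) : ℕ) = (k - (i.succ : ℕ)) + 1 := by
      have := i.2
      simp only [Fin.val_castSucc, Fin.val_succ]
      omega
    simp only [σ₀, h1]
    push_cast
    linear_combination (u i.castSucc + u i.succ + u (Fin.last k)
      + ((k - (i.succ : ℕ) : ℕ) : ZMod 2)) * two_eq_zero_zmod
  have hlast : σ₀ (Fin.last k) = 0 := by
    simp only [σ₀, Fin.val_last, Nat.sub_self, Nat.cast_zero, add_zero]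
    exact CharTwo.add_self_eq_zero _
  rw [Finset.sum_eq_single σ₀]
  · exact Finset.prod_eq_one fun i _ => hstep i
  · intro σ hσ hne
    by_contra hprod
    refine hne (funext fun i => ?_)
    induction i using Fin.reverseInduction with
    | last => rw [hlast, (Finset.mem_filter.1 hσ).2]
    | cast i ih =>
      have h1 := h01 _ (Finset.prod_ne_zero_iff.1 hprod i (Finset.mem_univ i))
      have h2 := hstep i
      linear_combination h1 - h2 - ih
  · intro h
    exact absurd (by simpa using hlast) h

/-! ### Evaluation of the power on the hemisphere cycle. -/

/-- The `k`-th power of the Stiefel-Whitney class of a space which receives an equivariant map from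
the `k`-sphere is nonzero. -/
theorem cupPow_stiefelWhitney_ne_zero {X : Type u} [TopologicalSpace X] {τ : FreeInvolution X}
    (hw : Nonempty (EquivMap τ antipodalInf)) {k : ℕ} (f : EquivMap (antipodal k) τ) :
    cupPow (stiefelWhitney τ) k ≠ 0 := by
  let φ : C(Metric.sphere (0 : EuclideanSpace ℝ (Fin (k + 1))) 1, τ.Orbit) := τ.proj.comp f.toMap
  have hφ : φ.comp (antipodal k).toMap = φ := by
    ext1 x
    show τ.proj (f.toMap ((antipodal k).toMap x)) = τ.proj (f.toMap x)
    rw [f.map_inv, τ.proj_toMap]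
  intro h0
  cases k with
  | zero =>
    -- In degree zero the only coboundary is `0`, and the orbit space has a point to evaluate on.
    have h1 : (fun _ => 1 : Cochain 0 τ.Orbit) ∈ coboundaries 0 τ.Orbit :=
      (cohomology_mk_eq_zero_iff _).1 h0
    have h2 : (fun _ => 1 : Cochain 0 τ.Orbit) = 0 := h1
    exact one_ne_zero (congrFun h2 (φ.comp (crossSimplex fun _ => 0)))
  | succ n =>
    obtain ⟨ζ, hζ⟩ := Submodule.Quotient.mk_surjective _ rpClass
    have hζ0 : ζ.1 ∉ coboundaries 1 RPInf := by
      rw [← cohomology_mk_eq_zero_iff, hζ]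
      exact rpClass_ne_zero
    obtain ⟨η, hη, hη1⟩ := exists_cochain_of_not_mem_coboundaries (LinearMap.mem_ker.1 ζ.2) hζ0
    let w := hw.some
    have hsw : stiefelWhitney τ = Submodule.Quotient.mk (cocycleMap 1 w.mapOrbit ζ) := by
      have h1 : stiefelWhitney τ = cohomologyMap 1 w.mapOrbit rpClass := dif_pos hw
      rw [h1, ← hζ]
      rfl
    obtain ⟨a, ha, hak⟩ := cupPow_mk (cocycleMap 1 w.mapOrbit ζ) (n + 1)
    rw [hsw, hak, cohomology_mk_eq_zero_iff, ha] at h0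
    obtain ⟨b, hb⟩ := h0
    -- the values on the edges
    let ω : Cochain 1 τ.Orbit := cochainMap 1 w.mapOrbit ζ.1
    let G := w.toMap.comp f.toMap
    -- The label of the vertex `± e_i`. It depends only on the sign at `i` and changes by `1` with
    -- it, since `G` is equivariant and `η` is odd.
    let v : (Fin (n + 1 + 1) → ZMod 2) → Fin (n + 1 + 1) → ZMod 2 := fun σ i =>
      η (G.comp (SingSimplex.reindex (crossSimplex σ) fun _ : Fin (0 + 1) => i))
    have hω : ∀ s : SingSimplex 1 (Metric.sphere (0 : EuclideanSpace ℝ (Fin (n + 1 + 1))) 1),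
        ω (φ.comp s) = η (G.comp (SingSimplex.reindex s fun _ => 0))
          + η (G.comp (SingSimplex.reindex s fun _ => 1)) := by
      intro s
      rw [← SingSimplex.comp_reindex, ← SingSimplex.comp_reindex, ← coboundary_zero_apply, hη]
      rfl
    have hv : ∀ σ i, v σ i = v 0 i + σ i := by
      intro σ i
      have h01 : ∀ b : ZMod 2, b = 0 ∨ b = 1 := by decide
      rcases h01 (σ i) with h | h
      · rw [h, add_zero]
        exact congrArg (fun s => η (G.comp s)) (crossSimplex_reindex_congr fun _ => h)
      · have h1 : SingSimplex.reindex (crossSimplex σ) (fun _ : Fin (0 + 1) => i)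
            = (antipodal (n + 1)).toMap.comp
              (SingSimplex.reindex (crossSimplex 0) fun _ : Fin (0 + 1) => i) := by
          rw [← SingSimplex.comp_reindex, ← crossSimplex_add_one]
          refine crossSimplex_reindex_congr fun _ => ?_
          rw [h, Pi.zero_apply, zero_add]
        have h2 : G.comp ((antipodal (n + 1)).toMap.comp
            (SingSimplex.reindex (crossSimplex 0) fun _ : Fin (0 + 1) => i))
            = antipodalInf.toMap.comp (G.comp
              (SingSimplex.reindex (crossSimplex 0) fun _ : Fin (0 + 1) => i)) := by
          ext1 x
          show w.toMap (f.toMap ((antipodal (n + 1)).toMap _)) = antipodalInf.toMap _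
          rw [f.map_inv, w.map_inv]
          rfl
        show η (G.comp _) = _
        rw [h1, h2, hη1, h]
    have hpow : ∀ σ : Fin (n + 1 + 1) → ZMod 2,
        cochainPow ω (n + 1) (φ.comp (crossSimplex σ))
          = ∏ i : Fin (n + 1), ((v 0 i.castSucc + σ i.castSucc) + (v 0 i.succ + σ i.succ)) := by
      intro σ
      rw [cochainPow_apply]
      refine Finset.prod_congr rfl fun i _ => ?_
      rw [SingSimplex.comp_reindex, hω, SingSimplex.reindex_reindex, SingSimplex.reindex_reindex,
        ← hv, ← hv]
      rfl
    -- The coboundary of `b` sums to `0` over the cycle, whereas the power sums to `1`.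
    have hsum := sum_coboundary_crossSimplex φ hφ b
    rw [show coboundary n τ.Orbit b = cochainPow ω (n + 1) from hb,
      Finset.sum_congr rfl fun σ _ => hpow σ, sum_prod_add_eq_one] at hsum
    exact one_ne_zero hsum

end ZTwo

theorem mainTheorem5 :
    (∀ {V : Type*} {W : Type*} (K : AbstractSimplicialComplex V) (L : AbstractSimplicialComplex W)
      (σ : ZTwo.SimplicialInvolution K) (hσ : σ.IsFree)
      (τ : ZTwo.FreeInvolution (ZTwo.Realization L))
      (k : ℕ) (_ : ZTwo.DimLE K k) (_ : ZTwo.IsNConnected ((k : ℤ) - 1) (ZTwo.Realization L))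
      (d : ℤ) (_ : -1 ≤ d) (ψ : ZTwo.EquivMap (σ.onSkeleton hσ d) τ),
      ∃ φ : ZTwo.EquivMap (σ.realize hσ) τ,
        ∀ x : ZTwo.skeleton K d, φ.toMap x.1 = ψ.toMap x) ∧
    (∀ {X : Type*} [TopologicalSpace X] [T2Space X] [Topology.CWComplex (Set.univ : Set X)]
      (τ : ZTwo.FreeInvolution X) (k : ℕ) (_ : ZTwo.IsNConnected ((k : ℤ) - 1) X),
      Nonempty (ZTwo.EquivMap (ZTwo.antipodal k) τ) ∧
        ZTwo.cupPow (ZTwo.stiefelWhitney τ) k ≠ 0) := by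
  refine ⟨fun K L σ hσ τ k hK hL d _ ψ => ZTwo.exists_equivMap_extending σ hσ τ k hK hL d ψ,
    fun τ k hX => ?_⟩
  obtain ⟨f⟩ := ZTwo.nonempty_equivMap_antipodal τ hX
  exact ⟨⟨f⟩, ZTwo.cupPow_stiefelWhitney_ne_zero (ZTwo.nonempty_equivMap_antipodalInf τ) f⟩
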